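/- **Proposition 4.1.** For a group $G$ let $G^{(0)}=G$ and $G^{(k+1)}=[G^{(k)},G^{(k)}]$ denote the derived series, and let $\Phi^{(k)}(G)\subseteq H_2(G;\mathbb{Z})$ be the image of the map $H_2(G^{(k)};\mathbb{Z})\to H_2(G;\mathbb{Z})$ induced by the inclusion $G^{(k)}\subseteq G$. Let $\langle\Phi^{(k)}(G)\rangle$ be the $\mathbb{Q}$-linear subspace of $H_2(G;\mathbb{Q})$ spanned by the image of $\Phi^{(k)}(G)$ under $H_2(G;\mathbb{Z})\to H_2(G;\mathbb{Q})$. Let $n\ge 1$, let $B$ be a finitely related group (that is, $B$ has a presentation with finitely many relations and a possibly infinite set of generators), let $\mathcal{A}\subseteq B$ be a (possibly infinite) subset, and let $A$ be the subgroup of $B$ generated by $\mathcal{A}$. Suppose that the classes in $H_1(B;\mathbb{Q})$ of the elements of $\mathcal{A}$ form a linearly independent family indexed by $\mathcal{A}$, and that $H_2(B;\mathbb{Q})=\langle\Phi^{(n-1)}(B)\rangle$. Let $F$ be the free group on $\mathcal{A}$. Then: 1. The canonical map $F\to A$ induces an isomorphism $F/F^{(n)}\cong A/A^{(n)}$; that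 is, $A/A^{(n)}$ is the free solvable group of derived length $n$ on $\mathcal{A}$. 2. There is a surjective homomorphism from $A$ onto the free solvable group $F/F^{(n)}$ that sends each $a\in\mathcal{A}$ to the class of the corresponding free generator. 3. If $n\ge 2$ and $|\mathcal{A}|>1$, then $A$ is not nilpotent. 4. The inclusion $A\subseteq B$ induces an injective homomorphism $A/A^{(n)}\to B/B^{(n)}$. -/

import Mathlib

open CategoryTheory

universe u

/-- `H_k(G; M)`, the homology of the group `G` with coefficients in the abelian group `M` on which
`G` acts trivially. It is the group homology over the base ring `ℤ`; `ULift` only adjusts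
universes. -/
noncomputable abbrev trivialHomology (G : Type u) [Group G] (M : Type) [AddCommGroup M] (k : ℕ) :
    ModuleCat.{u} (ULift.{u} ℤ) :=
  groupHomology (Rep.trivial (ULift.{u} ℤ) G (ULift.{u} M)) k

/-- An additive map `M → M'`, as a linear map between the universe lifts. -/
def coeffLinear {M M' : Type} [AddCommGroup M] [AddCommGroup M'] (f : M →+ M') :
    ULift.{u} M →ₗ[ULift.{u} ℤ] ULift.{u} M' where
  toFun m := ⟨f m.down⟩
  map_add' x y := by ext; simp
  map_smul' r x := by ext; simp

/-- The map `H_k(G; M) → H_k(G; M')` induced by a map `M → M'` of coefficient groups. -/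
noncomputable def coeffMap (G : Type u) [Group G] {M M' : Type} [AddCommGroup M] [AddCommGroup M']
    (f : M →+ M') (k : ℕ) :
    (trivialHomology G M k) →+ (trivialHomology G M' k) :=
  (((groupHomology.functor (ULift.{u} ℤ) G k).map
    ((Rep.trivialFunctor (ULift.{u} ℤ) G).map
      (ModuleCat.ofHom (coeffLinear.{u} f)))).hom).toAddMonoidHom

/-- The map `H_k(G; M) → H_k(G'; M)` induced by a group homomorphism `G → G'`. -/
noncomputable def inducedMap {G G' : Type u} [Group G] [Group G'] (φ : G →* G') (M : Type)
    [AddCommGroup M] (k : ℕ) :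
    (trivialHomology G M k) →+ (trivialHomology G' M k) :=
  (((groupHomology.coresNatTrans (ULift.{u} ℤ) φ k).app
    (Rep.trivial (ULift.{u} ℤ) G' (ULift.{u} M))).hom).toAddMonoidHom

lemma coeffMap_id (G : Type u) [Group G] (M : Type) [AddCommGroup M] (k : ℕ) :
    coeffMap G (AddMonoidHom.id M) k = AddMonoidHom.id _ := by
  have h : ModuleCat.ofHom (coeffLinear.{u} (AddMonoidHom.id M)) = 𝟙 _ := rfl
  unfold coeffMap
  rw [h, CategoryTheory.Functor.map_id, CategoryTheory.Functor.map_id]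
  rfl

lemma coeffMap_comp (G : Type u) [Group G] {M M' M'' : Type} [AddCommGroup M] [AddCommGroup M']
    [AddCommGroup M''] (g : M' →+ M'') (f : M →+ M') (k : ℕ) :
    coeffMap G (g.comp f) k = (coeffMap G g k).comp (coeffMap G f k) := by
  have h : ModuleCat.ofHom (coeffLinear.{u} (g.comp f)) =
      ModuleCat.ofHom (coeffLinear.{u} f) ≫ ModuleCat.ofHom (coeffLinear.{u} g) := rfl
  unfold coeffMap
  rw [h, CategoryTheory.Functor.map_comp, CategoryTheory.Functor.map_comp]
  rfl

lemma chainsFunctor_map_add (R G : Type u) [CommRing R] [Group G] {V W : Rep.{u} R G}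
    (φ ψ : V ⟶ W) :
    (groupHomology.chainsFunctor R G).map (φ + ψ) =
      (groupHomology.chainsFunctor R G).map φ + (groupHomology.chainsFunctor R G).map ψ := by
  refine HomologicalComplex.hom_ext _ _ fun i => ModuleCat.hom_ext ?_
  refine Finsupp.lhom_ext fun x a => ?_
  have h (χ : V ⟶ W) : (((groupHomology.chainsFunctor R G).map χ).f i).hom (Finsupp.single x a) =
      Finsupp.single x (χ.hom a) :=
    groupHomology.chainsMap_f_single (MonoidHom.id G) χ i x a
  exact (h _).trans ((Finsupp.single_add _ _ _).trans
    (congrArg₂ (fun y z => y + z) (h φ).symm (h ψ).symm))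

lemma coeffMap_add (G : Type u) [Group G] {M M' : Type} [AddCommGroup M] [AddCommGroup M']
    (f g : M →+ M') (k : ℕ) :
    coeffMap G (f + g) k = coeffMap G f k + coeffMap G g k := by
  have h := chainsFunctor_map_add (ULift.{u} ℤ) G
    ((Rep.trivialFunctor (ULift.{u} ℤ) G).map (ModuleCat.ofHom (coeffLinear.{u} f)))
    ((Rep.trivialFunctor (ULift.{u} ℤ) G).map (ModuleCat.ofHom (coeffLinear.{u} g)))
  have h2 := congrArg (fun c => ((HomologicalComplex.homologyMap c k).hom).toAddMonoidHom) h
  exact h2.trans (by rw [HomologicalComplex.homologyMap_add]; rfl)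

/-- `H_k(G; ℚ)` is a rational vector space: `q : ℚ` acts through multiplication by `q` on the
coefficients. -/
noncomputable instance rationalModule (G : Type u) [Group G] (k : ℕ) :
    Module ℚ (trivialHomology G ℚ k) where
  smul q x := coeffMap G (AddMonoidHom.mulLeft q) k x
  one_smul x := by
    have h : AddMonoidHom.mulLeft (1 : ℚ) = AddMonoidHom.id ℚ := by ext; simp
    change coeffMap G (AddMonoidHom.mulLeft 1) k x = x
    rw [h, coeffMap_id]; rfl
  mul_smul q r x := by
    have h : AddMonoidHom.mulLeft (q * r) =
        (AddMonoidHom.mulLeft q).comp (AddMonoidHom.mulLeft r) := by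
      ext; simp [mul_assoc]
    change coeffMap G (AddMonoidHom.mulLeft (q * r)) k x = _
    rw [h, coeffMap_comp]; rfl
  smul_zero q := map_zero _
  smul_add q := map_add _
  add_smul q r x := by
    have h : AddMonoidHom.mulLeft (q + r) =
        AddMonoidHom.mulLeft q + AddMonoidHom.mulLeft r := by
      ext; simp [add_mul]
    change coeffMap G (AddMonoidHom.mulLeft (q + r)) k x = _
    rw [h, coeffMap_add]; rfl
  zero_smul x := by
    have h : coeffMap G (0 : ℚ →+ ℚ) k = 0 := by
      have h0 := coeffMap_add G (0 : ℚ →+ ℚ) 0 k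
      rw [add_zero] at h0
      exact left_eq_add.mp h0
    have h' : AddMonoidHom.mulLeft (0 : ℚ) = 0 := by ext; simp
    change coeffMap G (AddMonoidHom.mulLeft 0) k x = 0
    rw [h', h]; rfl

/-- The class in `H_1(G; ℚ)` of an element `g` of the group `G`. -/
noncomputable def rationalClass (G : Type u) [Group G] (g : G) : trivialHomology G ℚ 1 :=
  groupHomology.mkH1OfIsTrivial (Rep.trivial (ULift.{u} ℤ) G (ULift.{u} ℚ))
    (Additive.ofMul (Abelianization.of g)) (ULift.up (1 : ℚ))

/-- `Φ^N(G)`: the image of the map `H_2(N; ℤ) → H_2(G; ℤ)` induced by the inclusion of `N`. -/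
noncomputable def surfaceSubgroup {G : Type u} [Group G] (N : Subgroup G) :
    AddSubgroup (trivialHomology G ℤ 2) :=
  (inducedMap N.subtype ℤ 2).range

/-- `⟨Φ^N(G)⟩`: the rational subspace of `H_2(G; ℚ)` spanned by the image of `Φ^N(G)` under
`H_2(G; ℤ) → H_2(G; ℚ)`. -/
noncomputable def rationalSurfaceSpan {G : Type u} [Group G] (N : Subgroup G) :
    Submodule ℚ (trivialHomology G ℚ 2) :=
  Submodule.span ℚ
    (coeffMap G (Int.castAddHom ℚ) 2 '' (surfaceSubgroup N : Set (trivialHomology G ℤ 2)))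

/-- A group is finitely related if it has a presentation with finitely many relations; the set of
generators may be infinite. -/
def FinitelyRelated (G : Type u) [Group G] : Prop :=
  ∃ (α : Type u) (rels : Set (FreeGroup α)),
    rels.Finite ∧ Nonempty (G ≃* PresentedGroup rels)

/-- `G / G^{(n)}`, the quotient of a group by the `n`-th term of its derived series. For `G` a free
group, this is the free solvable group of derived length `n`. -/
abbrev derivedQuotient (G : Type u) [Group G] (n : ℕ) : Type u := G ⧸ derivedSeries G n

/-- The homomorphism `G / G^{(n)} → G' / G'^{(n)}` induced by a homomorphism `G → G'`. -/
def derivedQuotientMap {G G' : Type u} [Group G] [Group G'] (φ : G →* G') (n : ℕ) :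
    derivedQuotient G n →* derivedQuotient G' n :=
  QuotientGroup.map _ _ φ (Subgroup.map_le_iff_le_comap.mp (map_derivedSeries_le_derivedSeries φ n))

/-- The canonical homomorphism from the free group on a subset of `B` to the subgroup which that
subset generates. -/
def freeToClosure {B : Type u} [Group B] (S : Set B) : FreeGroup S →* Subgroup.closure S :=
  FreeGroup.lift fun a => ⟨a.1, Subgroup.subset_closure a.2⟩

/-!
Let `φ : F → B` be the homomorphism from the free group on `S`. Everything follows once `φ x ∈ B⁽ⁿ⁾`
implies `x ∈ F⁽ⁿ⁾`: the map from `F / F⁽ⁿ⁾` to `B / B⁽ⁿ⁾` factors through the quotient of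
`A = closure S`, onto which `F / F⁽ⁿ⁾` surjects; and for `n ≥ 2` and at least two generators,
`F / F⁽ⁿ⁾` maps onto the symmetric group `S₃`, which is not nilpotent.

The derived series of `B` is replaced by the larger rational derived series `B_k`, whose successive
quotients are torsion-free abelian, and `φ⁻¹(B_k) ≤ F⁽ᵏ⁾` is shown by induction on `k ≤ n`
(`comap_rationalDerivedSeries_le`). Put `Γ = B / B_k` and let `x` be an element with
`φ x ∈ B_{k+1}`. Fox calculus over `ℚ[Γ]`, for a presentation of `B` with finitely many relators,
expresses this as follows: the vector `∑ (∂x/∂a) D a` lies in the span of the Fox derivatives `D r`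
of the relators. If the vectors `D a`, for `a ∈ S`, are independent modulo the `D r`, all `∂x/∂a`
vanish, and the faithfulness of the Magnus embedding (`mem_commutator_of_fox`) gives `x ∈ F⁽ᵏ⁺¹⁾`.

After augmentation to `ℚ`, the `D a` are independent modulo the `D r`, by the hypothesis on `H_1`.
Strebel's theorem (`strebelProperty_of_extension`) says that augmentation detects independence over
`ℚ[Γ]`, but the augmented `D r` may themselves be dependent. The relations between them form
`H_2` of the presentation complex, and the hypothesis on `H_2(B; ℚ)` says exactly that these
relations lift to `ℚ[Γ]`: surface classes from `B⁽ⁿ⁻¹⁾`, a subgroup that dies in `Γ`, and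
identities among the relators both lift. The formal version is `exists_lift_relation`, which
rests on the extension theorem `exists_hom_extending` for homomorphisms on the relation subgroup. As
there are finitely many relators and `ℚ[Γ]` is a domain with the strong rank condition, the lifted
relations make the redundant `D r` dependent on the others also over `ℚ[Γ]`
(`eq_zero_of_mem_span_relations`). The three properties of `ℚ[Γ]` which are used, collected in
`IsTame`, hold for torsion-free abelian groups and pass to extensions.
-/

section GroupRings

open MonoidAlgebra groupHomology

/-! ### Augmentation -/

/-- The augmentation `ℚ[G] → ℚ`, sending every group element to `1`. -/
noncomputable def augmentation (G : Type u) [Group G] : MonoidAlgebra ℚ G →ₐ[ℚ] ℚ :=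
  MonoidAlgebra.lift ℚ ℚ G 1

@[simp] lemma augmentation_single {G : Type u} [Group G] (g : G) (q : ℚ) :
    augmentation G (single g q) = q := by simp [augmentation]

/-- The coordinatewise augmentation of a vector over a group ring. -/
noncomputable def augVec (κ : Type u) (G : Type u) [Group G] :
    (κ →₀ MonoidAlgebra ℚ G) →ₗ[ℚ] (κ →₀ ℚ) :=
  Finsupp.mapRange.linearMap (augmentation G).toLinearMap

@[simp] lemma augVec_single {κ G : Type u} [Group G] (k : κ) (a : MonoidAlgebra ℚ G) :
    augVec κ G (Finsupp.single k a) = Finsupp.single k (augmentation G a) := by simp [augVec]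

lemma augVec_smul {κ G : Type u} [Group G] (a : MonoidAlgebra ℚ G)
    (v : κ →₀ MonoidAlgebra ℚ G) : augVec κ G (a • v) = augmentation G a • augVec κ G v := by
  ext k; simp [augVec]

/-- Over a commutative domain, a family of vectors that is independent after augmentation is
independent: a left inverse of the augmented family has rational coefficients, so it lifts to the
domain and turns each finite subfamily into a square matrix whose determinant has augmentation `1`.
-/
theorem linearIndependent_of_augmentation {R : Type*} [CommRing R] [IsDomain R] [Algebra ℚ R]
    (ε : R →ₐ[ℚ] ℚ) {ι κ : Type*} (t : ι → κ →₀ R)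
    (h : LinearIndependent ℚ fun i => Finsupp.mapRange.linearMap ε.toLinearMap (t i)) :
    LinearIndependent R t := by
  classical
  rw [linearIndependent_iff_finset_linearIndependent] at h ⊢
  intro s
  have hs := h s
  set e : (κ →₀ R) →ₗ[ℚ] (κ →₀ ℚ) := Finsupp.mapRange.linearMap ε.toLinearMap with he
  obtain ⟨g, hg⟩ := LinearMap.exists_leftInverse_of_injective _
    (LinearMap.ker_eq_bot.mpr hs)
  set c : (κ →₀ ℚ) →ₗ[ℚ] (s → ℚ) := (Finsupp.lcoeFun).comp g with hc
  have hcv : ∀ i : s, c (e (t i)) = Pi.single i 1 := by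
    intro i
    have := LinearMap.congr_fun hg (Finsupp.single i 1)
    simp only [LinearMap.comp_apply, Finsupp.linearCombination_single, one_smul] at this
    simp only [hc, LinearMap.comp_apply]
    erw [this]
    ext j
    simp [Finsupp.single_apply, Pi.single_apply, eq_comm]
  let C : (κ →₀ R) →ₗ[R] (s → R) :=
    Finsupp.linearCombination R fun k j => algebraMap ℚ R (c (Finsupp.single k 1) j)
  have hC : ∀ v j, ε (C v j) = c (e v) j := by
    intro v j
    induction v using Finsupp.induction_linear with
    | zero => simp
    | add x y hx hy => simp [hx, hy]
    | single k a =>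
      have : Finsupp.single k (ε a) = ε a • Finsupp.single k (1 : ℚ) := by simp
      simp [C, he, this, -Finsupp.smul_single]
  refine LinearIndependent.of_comp C (Matrix.linearIndependent_rows_of_det_ne_zero
    (A := Matrix.of fun i j : s => C (t i) j) fun h0 => ?_)
  have := congrArg ε h0
  rw [← AlgHom.coe_toRingHom, RingHom.map_det] at this
  have hM : (ε : R →+* ℚ).mapMatrix (Matrix.of fun i j : s => C (t i) j) = 1 := by
    ext i j
    simp [hC, hcv, Matrix.one_apply, Pi.single_apply, eq_comm]
  rw [hM] at this
  simp at this

/-! ### Unique products -/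

/-- Mathlib has this for finitely generated groups, and only finitely many elements are involved. -/
lemma uniqueProds_of_torsionFree (G : Type u) [CommGroup G] [IsMulTorsionFree G] :
    UniqueProds G where
  uniqueMul_of_nonempty {A B} hA hB := by
    classical
    let H := Subgroup.closure ((A ∪ B : Finset G) : Set G)
    have hAB : ∀ x ∈ A ∪ B, x ∈ H := fun x hx => Subgroup.subset_closure hx
    have : Group.FG H := (Group.fg_iff_subgroup_fg _).mpr ⟨_, rfl⟩
    have : Monoid.FG H := Group.fg_iff_monoid_fg.mp inferInstance
    have : IsMulTorsionFree H :=
      ⟨fun n hn x y hxy => Subtype.ext (pow_left_injective hn (congrArg Subtype.val hxy))⟩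
    have hA' : (A.subtype (· ∈ H)).Nonempty := by
      obtain ⟨a, ha⟩ := hA
      exact ⟨⟨a, hAB a (by simp [ha])⟩, by simpa using ha⟩
    have hB' : (B.subtype (· ∈ H)).Nonempty := by
      obtain ⟨a, ha⟩ := hB
      exact ⟨⟨a, hAB a (by simp [ha])⟩, by simpa using ha⟩
    obtain ⟨a, ha, b, hb, hab⟩ := UniqueProds.uniqueMul_of_nonempty hA' hB'
    refine ⟨a, by simpa using ha, b, by simpa using hb, fun x y hx hy hxy => ?_⟩
    have := hab (a := ⟨x, hAB x (by simp [hx])⟩) (b := ⟨y, hAB y (by simp [hy])⟩)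
      (by simpa using hx) (by simpa using hy) (Subtype.ext hxy)
    simpa [Subtype.ext_iff] using this

lemma uniqueProds_of_extension {G Q : Type*} [Group G] [Group Q] (f : G →* Q)
    (hN : UniqueProds f.ker) (hQ : UniqueProds Q) : UniqueProds G where
  uniqueMul_of_nonempty {A B} hA hB := by
    classical
    obtain ⟨x, hx, y, hy, hxy⟩ := UniqueProds.uniqueMul_of_nonempty (hA.image f) (hB.image f)
    simp only [Finset.mem_image] at hx hy
    obtain ⟨a, ha, rfl⟩ := hx
    obtain ⟨b, hb, rfl⟩ := hy
    -- Translate the fibres over a unique product of the images into the kernel.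
    let A' : Finset f.ker := (A.image (a⁻¹ * ·)).subtype (· ∈ f.ker)
    let B' : Finset f.ker := (B.image (· * b⁻¹)).subtype (· ∈ f.ker)
    have hA' : A'.Nonempty := ⟨1, by simpa [A'] using ha⟩
    have hB' : B'.Nonempty := ⟨1, by simpa [B'] using hb⟩
    obtain ⟨p, hp, r, hr, hpr⟩ := UniqueProds.uniqueMul_of_nonempty hA' hB'
    have hpA : a * p ∈ A := by
      simp only [A', Finset.mem_subtype, Finset.mem_image] at hp
      obtain ⟨z, hz, hz'⟩ := hp
      rw [← hz']; simpa using hz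
    have hrB : r * b ∈ B := by
      simp only [B', Finset.mem_subtype, Finset.mem_image] at hr
      obtain ⟨z, hz, hz'⟩ := hr
      rw [← hz']; simpa using hz
    have hp1 : f p = 1 := p.2
    have hr1 : f r = 1 := r.2
    refine ⟨a * p, hpA, r * b, hrB, UniqueMul.of_image_filter (f : G →ₙ* Q)
      (aH := f a) (bH := f b) (by simp [hp1]) (by simp [hr1]) hxy ?_⟩
    intro x y hx hy hxy'
    rw [Finset.mem_filter] at hx hy
    replace hx : x ∈ A ∧ f x = f a := hx
    replace hy : y ∈ B ∧ f y = f b := hy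
    have hxk : a⁻¹ * x ∈ f.ker := by simp [MonoidHom.mem_ker, hx.2]
    have hyk : y * b⁻¹ ∈ f.ker := by simp [MonoidHom.mem_ker, hy.2]
    have := hpr (a := ⟨a⁻¹ * x, hxk⟩) (b := ⟨y * b⁻¹, hyk⟩)
      (by simpa [A', MonoidHom.mem_ker, hx.2] using hx.1)
      (by simpa [B', MonoidHom.mem_ker, hy.2] using hy.1)
      (Subtype.ext (by
        have : x * y = a * (p * r) * b := by rw [hxy']; group
        simp only [Subgroup.coe_mul]
        rw [show a⁻¹ * x * (y * b⁻¹) = a⁻¹ * (x * y) * b⁻¹ by group, this]; group))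
    simp only [Subtype.ext_iff] at this
    exact ⟨by rw [← this.1]; group, by rw [← this.2]; group⟩

/-! ### The Følner condition and the strong rank condition -/

/-- The Følner condition (for translation on the right): every finite set `K` admits finite
nonempty sets `E` whose product with `K` is contained in a set that is hardly larger than `E`. -/
def FolnerCondition (G : Type*) [Group G] : Prop :=
  ∀ (K : Finset G) (c : ℝ), 1 < c → ∃ E E' : Finset G, E.Nonempty ∧
    (∀ x ∈ E, ∀ k ∈ K, x * k ∈ E') ∧ (E'.card : ℝ) ≤ c * E.card

lemma folnerCondition_of_comm (G : Type*) [CommGroup G] : FolnerCondition G := by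
  classical
  intro K c hc
  by_contra! hcon
  -- The box `E M` has at most `(M + 1) ^ #K` elements, while failure of the Følner condition would
  -- force the boxes to grow exponentially.
  let E : ℕ → Finset G := fun M =>
    (Fintype.piFinset fun _ : K => Finset.range (M + 1)).image fun e => ∏ k : K, (k : G) ^ e k
  have hE : ∀ M, (E M).Nonempty := fun M => by
    refine Finset.Nonempty.image ⟨0, ?_⟩ _
    simp
  have hcard : ∀ M, (E M).card ≤ (M + 1) ^ K.card := fun M =>
    Finset.card_image_le.trans (by simp)
  have hsub : ∀ M, ∀ x ∈ E M, ∀ k ∈ K, x * k ∈ E (M + 1) := by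
    intro M y hy k hk
    obtain ⟨e, he, rfl⟩ := Finset.mem_image.mp hy
    simp only [Fintype.mem_piFinset, Finset.mem_range] at he
    refine Finset.mem_image.mpr ⟨e + Pi.single ⟨k, hk⟩ 1, ?_, ?_⟩
    · simp only [Fintype.mem_piFinset, Finset.mem_range, Pi.add_apply]
      intro a
      have := he a
      by_cases h : a = ⟨k, hk⟩
      · subst h; simp; omega
      · simp [h]; omega
    · simp only [Pi.add_apply, pow_add, Finset.prod_mul_distrib]
      congr 1
      rw [Finset.prod_eq_single ⟨k, hk⟩] <;> simp +contextual
  have hlow : ∀ M, c ^ M ≤ ((E M).card : ℝ) := by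
    intro M
    induction M with
    | zero =>
      simpa [Nat.one_le_iff_ne_zero, Finset.card_eq_zero, ← Finset.nonempty_iff_ne_empty] using hE 0
    | succ M ih =>
      have h1 := hcon (E M) (E (M + 1)) (hE M) (hsub M)
      rw [pow_succ']
      have : c * c ^ M ≤ c * (E M).card := by gcongr
      exact this.trans h1.le
  have ht := tendsto_pow_const_div_const_pow_of_one_lt K.card hc
  have ht' := (Filter.tendsto_add_atTop_iff_nat 1).mpr ht
  have hlt : ∀ᶠ M : ℕ in Filter.atTop, ((M + 1 : ℕ) : ℝ) ^ K.card / c ^ (M + 1) < c⁻¹ :=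
    ht'.eventually (gt_mem_nhds (by positivity))
  obtain ⟨M, hM⟩ := hlt.exists
  have h3 : c ^ M ≤ ((M + 1 : ℕ) : ℝ) ^ K.card := (hlow M).trans (by exact_mod_cast hcard M)
  rw [div_lt_iff₀ (by positivity), pow_succ', inv_mul_cancel_left₀ (by positivity)] at hM
  linarith

lemma folnerCondition_of_extension {G Q : Type*} [Group G] [Group Q] (f : G →* Q)
    (hf : Function.Surjective f) (hN : FolnerCondition f.ker) (hQ : FolnerCondition Q) :
    FolnerCondition G := by
  classical
  intro K c hc
  have hsq : (1 : ℝ) < √c := by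
    rw [Real.lt_sqrt (by norm_num)]; simpa using hc
  obtain ⟨F, F', hF, hFF, hFK⟩ := hQ (K.image f) _ hsq
  obtain ⟨s, hs⟩ : ∃ s : Q → G, ∀ q, f (s q) = q :=
    ⟨Function.surjInv hf, Function.surjInv_eq hf⟩
  -- the section `s` fails to be a homomorphism by the cocycle `γ`
  let γ : Q → G → f.ker := fun q k => ⟨s q * k * (s (q * f k))⁻¹, by simp [MonoidHom.mem_ker, hs]⟩
  obtain ⟨E, E', hE, hEE, hEK⟩ := hN ((F ×ˢ K).image fun p => γ p.1 p.2) _ hsq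
  let j : f.ker × Q → G := fun p => p.1 * s p.2
  have hj : Function.Injective j := by
    rintro ⟨a, q⟩ ⟨b, r⟩ h
    have h1 : q = r := by
      have := congrArg f h
      simpa [j, hs, MonoidHom.mem_ker.mp a.2, MonoidHom.mem_ker.mp b.2] using this
    subst h1
    exact Prod.ext (Subtype.ext (mul_right_cancel (h : (a : G) * s q = b * s q))) rfl
  refine ⟨(E ×ˢ F).image j, (E' ×ˢ F').image j, (hE.product hF).image _, ?_, ?_⟩
  · intro x hx k hk
    obtain ⟨⟨n, q⟩, hnq, rfl⟩ := Finset.mem_image.mp hx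
    obtain ⟨hn, hq⟩ := Finset.mem_product.mp hnq
    refine Finset.mem_image.mpr ⟨(n * γ q k, q * f k), Finset.mem_product.mpr
      ⟨hEE _ hn _ (Finset.mem_image.mpr ⟨(q, k), by simp [hq, hk], rfl⟩),
       hFF _ hq _ (Finset.mem_image_of_mem _ hk)⟩, ?_⟩
    simp [j, γ, mul_assoc]
  · rw [Finset.card_image_of_injective _ hj, Finset.card_product,
      Finset.card_image_of_injective _ hj, Finset.card_product]
    push_cast
    calc (E'.card : ℝ) * F'.card ≤ (√c * E.card) * (√c * F.card) := by gcongr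
      _ = (√c * √c) * (E.card * F.card) := by ring
      _ = c * (E.card * F.card) := by rw [Real.mul_self_sqrt (zero_le_one.trans hc.le)]

/-- The strong rank condition for group rings of amenable groups: more vectors than coordinates are
linearly dependent. Translates of the vectors by a Følner set `E` have their coefficients in a set
hardly larger than `E`, so they satisfy a rational linear relation for dimension reasons. -/
lemma not_linearIndependent_of_folnerCondition {G : Type*} [Group G] (hG : FolnerCondition G)
    {ι κ : Type*} [Fintype ι] [Fintype κ] (h : Fintype.card κ < Fintype.card ι)
    (t : ι → κ →₀ MonoidAlgebra ℚ G) : ¬ LinearIndependent (MonoidAlgebra ℚ G) t := by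
  classical
  intro hli
  let K : Finset G := Finset.univ.biUnion fun p : ι × κ => (t p.1 p.2).coeff.support
  have hK : ∀ i k x, x ∉ K → (t i k).coeff x = 0 := by
    intro i k x hx
    by_contra h0
    exact hx (Finset.mem_biUnion.mpr ⟨(i, k), Finset.mem_univ _, Finsupp.mem_support_iff.mpr h0⟩)
  have hι : (0 : ℝ) < Fintype.card ι := by exact_mod_cast (Nat.zero_le _).trans_lt h
  have hb : (0 : ℝ) < Fintype.card κ + 1 / 2 := by positivity
  have hlt : (Fintype.card κ : ℝ) + 1 ≤ Fintype.card ι := by exact_mod_cast h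
  obtain ⟨E, E', hE, hEE, hcard⟩ := hG K
    (Fintype.card ι / (Fintype.card κ + 1 / 2)) (by rw [one_lt_div hb]; linarith)
  have hE0 : (0 : ℝ) < E.card := by exact_mod_cast hE.card_pos
  have hcard' : Fintype.card (κ × E') < Fintype.card (E × ι) := by
    simp only [Fintype.card_prod, Fintype.card_coe]
    rw [← Nat.cast_lt (α := ℝ)]
    push_cast
    rw [div_mul_eq_mul_div, le_div_iff₀ hb] at hcard
    rcases Nat.eq_zero_or_pos E'.card with h0 | h0
    · rw [h0]; simp only [Nat.cast_zero, mul_zero]; positivity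
    · have : (0 : ℝ) < E'.card := by exact_mod_cast h0
      nlinarith
  have hli' : LinearIndependent ℚ fun p : G × ι => MonoidAlgebra.basis G ℚ p.1 • t p.2 :=
    linearIndependent_smul (MonoidAlgebra.basis G ℚ).linearIndependent hli
  have hli2 := hli'.comp (fun p : E × ι => ((p.1 : G), p.2)) fun p q hpq =>
    Prod.ext (Subtype.ext (congrArg Prod.fst hpq :))
      (congrArg Prod.snd hpq :)
  -- restriction of the coefficients to `E'`
  let P : (κ →₀ MonoidAlgebra ℚ G) →ₗ[ℚ] (κ × E' → ℚ) :=
    { toFun := fun v p => (v p.1).coeff p.2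
      map_add' := fun _ _ => rfl
      map_smul' := fun _ _ => rfl }
  have hP : LinearIndependent ℚ fun p : E × ι => P (MonoidAlgebra.basis G ℚ p.1 • t p.2) := by
    rw [Fintype.linearIndependent_iff] at hli2 ⊢
    intro c hc
    refine hli2 c ?_
    simp only [← map_smul, ← map_sum] at hc
    ext k g
    by_cases hg : g ∈ E'
    · exact congrFun hc (k, ⟨g, hg⟩)
    · rw [Finsupp.finsetSum_apply, coeff_sum, Finsupp.finsetSum_apply]
      refine Finset.sum_eq_zero fun p _ => ?_
      have : (t p.2 k).coeff ((p.1 : G)⁻¹ * g) = 0 := by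
        refine hK _ _ _ fun hx => hg ?_
        simpa using hEE p.1 p.1.2 _ hx
      simp [this]
  have := hP.fintype_card_le_finrank
  rw [Module.finrank_fintype_fun_eq_card] at this
  exact absurd this (by simpa using hcard')

/-! ### Strebel's property -/

/-- The `ℚ`-linear map on `ℚ[G]^(κ)` with prescribed values on the rational basis `κ × G`. -/
noncomputable def basisLift {κ G : Type*} {M : Type*} [AddCommGroup M] [Module ℚ M] (b : κ → G → M) :
    (κ →₀ MonoidAlgebra ℚ G) →ₗ[ℚ] M :=
  Finsupp.lsum ℚ fun k => (Finsupp.linearCombination ℚ (b k)).comp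
    (MonoidAlgebra.coeffLinearEquiv ℚ).toLinearMap

@[simp] lemma basisLift_single {κ G : Type*} {M : Type*} [AddCommGroup M] [Module ℚ M]
    (b : κ → G → M) (k : κ) (g : G) (q : ℚ) :
    basisLift b (Finsupp.single k (single g q)) = q • b k g := by
  simp [basisLift]

lemma finsupp_monoidAlgebra_hom_ext {κ G : Type*} {M : Type*} [AddCommGroup M] [Module ℚ M]
    {f h : (κ →₀ MonoidAlgebra ℚ G) →ₗ[ℚ] M}
    (H : ∀ k g, f (Finsupp.single k (single g 1)) = h (Finsupp.single k (single g 1))) : f = h := by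
  ext k g
  simpa using H k g

/-- Strebel's property `D(ℚ)` of a group `G`: a family of vectors in a free `ℚ[G]`-module is linearly
independent over `ℚ[G]` as soon as its augmentation is linearly independent over `ℚ`. -/
def StrebelProperty (G : Type u) [Group G] : Prop :=
  ∀ (ι κ : Type u) (t : ι → κ →₀ MonoidAlgebra ℚ G),
    LinearIndependent ℚ (fun i => augVec κ G (t i)) → LinearIndependent (MonoidAlgebra ℚ G) t

lemma strebelProperty_of_torsionFree (G : Type u) [CommGroup G] [IsMulTorsionFree G] :
    StrebelProperty G := by
  have := uniqueProds_of_torsionFree G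
  exact fun ι κ t h => linearIndependent_of_augmentation (augmentation G) t h

/-- The coordinatewise map on vectors over group rings that a group homomorphism induces. -/
noncomputable def pushVec (κ : Type*) {G Q : Type*} [Group G] [Group Q] (f : G →* Q) :
    (κ →₀ MonoidAlgebra ℚ G) →ₗ[ℚ] (κ →₀ MonoidAlgebra ℚ Q) :=
  Finsupp.mapRange.linearMap (mapDomainAlgHom ℚ ℚ f).toLinearMap

@[simp] lemma pushVec_single (κ : Type*) {G Q : Type*} [Group G] [Group Q] (f : G →* Q)
    (k : κ) (a : MonoidAlgebra ℚ G) :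
    pushVec κ f (Finsupp.single k a) = Finsupp.single k (mapDomainAlgHom ℚ ℚ f a) := by
  simp [pushVec]

lemma pushVec_smul {κ : Type*} {G Q : Type*} [Group G] [Group Q] (f : G →* Q)
    (a : MonoidAlgebra ℚ G) (v : κ →₀ MonoidAlgebra ℚ G) :
    pushVec κ f (a • v) = mapDomainAlgHom ℚ ℚ f a • pushVec κ f v := by
  ext1 k; simp [pushVec, -mapDomainAlgHom_apply]

lemma augVec_pushVec {κ G Q : Type u} [Group G] [Group Q] (f : G →* Q)
    (v : κ →₀ MonoidAlgebra ℚ G) : augVec κ Q (pushVec κ f v) = augVec κ G v := by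
  refine LinearMap.congr_fun (f := (augVec κ Q).comp (pushVec κ f))
    (finsupp_monoidAlgebra_hom_ext fun k g => ?_) v
  simp

/-- Strebel's property passes to extensions: a free `ℚ[G]`-module is free over the group ring of the
kernel `N`, with coinvariants a free module over `ℚ[Q]`. Independence over `ℚ` of the augmentation
gives independence over `ℚ[Q]` of the image of the family, that is, independence over `ℚ` of the
augmentation of its translates by coset representatives of `N`. -/
lemma strebelProperty_of_extension {G Q : Type u} [Group G] [Group Q] (f : G →* Q)
    (hf : Function.Surjective f) (hN : StrebelProperty f.ker) (hQ : StrebelProperty Q) :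
    StrebelProperty G := by
  classical
  intro ι κ t ht
  obtain ⟨s, hs⟩ : ∃ s : Q → G, ∀ q, f (s q) = q :=
    ⟨Function.surjInv hf, Function.surjInv_eq hf⟩
  let n : G → f.ker := fun g => ⟨g * (s (f g))⁻¹, by simp [MonoidHom.mem_ker, hs]⟩
  -- the coordinates of `ℚ[G]^(κ)` over `ℚ[N]`, with respect to the coset representatives `s`
  let φ : ∀ κ : Type u, (κ →₀ MonoidAlgebra ℚ G) →ₗ[ℚ] (κ × Q →₀ MonoidAlgebra ℚ f.ker) :=
    fun κ => basisLift fun k g => Finsupp.single (k, f g) (single (n g) 1)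
  have hφ : ∀ κ k g, φ κ (Finsupp.single k (single g 1)) =
      Finsupp.single (k, f g) (single (n g) 1) := fun κ k g => by simp [φ]
  let ψ : (ι × Q →₀ MonoidAlgebra ℚ f.ker) →ₗ[ℚ] (ι →₀ MonoidAlgebra ℚ G) :=
    basisLift fun p m => Finsupp.single p.1 (single ((m : G) * s p.2) 1)
  have hψφ : ∀ a, ψ (φ ι a) = a := by
    intro a
    refine LinearMap.congr_fun (f := ψ.comp (φ ι)) (g := LinearMap.id)
      (finsupp_monoidAlgebra_hom_ext fun k g => ?_) a
    simp [hφ, ψ, n]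
  let u : ι × Q → (κ × Q →₀ MonoidAlgebra ℚ f.ker) := fun p =>
    φ κ (single (s p.2) (1 : ℚ) • t p.1)
  have hequiv : ∀ (m : f.ker) (v : κ →₀ MonoidAlgebra ℚ G),
      φ κ (single (m : G) (1 : ℚ) • v) = single m (1 : ℚ) • φ κ v := by
    intro m v
    refine LinearMap.congr_fun
      (f := (φ κ).comp (Algebra.lsmul ℚ ℚ _ (single (m : G) (1 : ℚ))))
      (g := (Algebra.lsmul ℚ ℚ _ (single m (1 : ℚ))).comp (φ κ))
      (finsupp_monoidAlgebra_hom_ext fun k g => ?_) v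
    have hm : f m = 1 := m.2
    have hn : n (m * g) = m * n g := Subtype.ext (by simp [n, hm, mul_assoc])
    simp [hφ, hm, hn]
  have hcomb : ∀ a, φ κ (Finsupp.linearCombination _ t a) =
      Finsupp.linearCombination (MonoidAlgebra ℚ f.ker) u (φ ι a) := by
    intro a
    refine LinearMap.congr_fun
      (f := (φ κ).comp ((Finsupp.linearCombination (MonoidAlgebra ℚ G) t).restrictScalars ℚ))
      (g := ((Finsupp.linearCombination (MonoidAlgebra ℚ f.ker) u).restrictScalars ℚ).comp (φ ι))
      (finsupp_monoidAlgebra_hom_ext fun i g => ?_) a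
    have hg : single g (1 : ℚ) = single (n g : G) 1 * single (s (f g)) 1 := by simp [n]
    simp only [LinearMap.comp_apply, LinearMap.restrictScalars_apply, hφ,
      Finsupp.linearCombination_single, u]
    rw [hg, mul_smul, hequiv]
  have hu : LinearIndependent (MonoidAlgebra ℚ f.ker) u := by
    refine hN _ _ u ?_
    let Λ : (κ →₀ MonoidAlgebra ℚ Q) →ₗ[ℚ] (κ × Q →₀ ℚ) :=
      basisLift fun k q => Finsupp.single (k, q) 1
    have hΛ : Function.Injective Λ := by
      let Λ' : (κ × Q →₀ ℚ) →ₗ[ℚ] (κ →₀ MonoidAlgebra ℚ Q) :=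
        Finsupp.linearCombination ℚ fun p => Finsupp.single p.1 (single p.2 1)
      refine Function.LeftInverse.injective (g := Λ') fun v => ?_
      refine LinearMap.congr_fun (f := Λ'.comp Λ) (g := LinearMap.id)
        (finsupp_monoidAlgebra_hom_ext fun k g => ?_) v
      simp [Λ, Λ']
    have haug : ∀ v, augVec _ _ (φ κ v) = Λ (pushVec κ f v) := by
      intro v
      refine LinearMap.congr_fun (f := (augVec _ _).comp (φ κ)) (g := Λ.comp (pushVec κ f))
        (finsupp_monoidAlgebra_hom_ext fun k g => ?_) v
      simp [Λ, hφ]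
    have hpush : LinearIndependent (MonoidAlgebra ℚ Q) fun i => pushVec κ f (t i) :=
      hQ _ _ _ (by simpa only [augVec_pushVec] using ht)
    have h2 := (linearIndependent_smul (MonoidAlgebra.basis Q ℚ).linearIndependent hpush).map' Λ
      (LinearMap.ker_eq_bot.mpr hΛ)
    have heq : (fun p => augVec (κ × Q) f.ker (u p)) =
        (Λ ∘ fun p => MonoidAlgebra.basis Q ℚ p.1 • pushVec κ f (t p.2)) ∘ Prod.swap := by
      ext1 ⟨i, q⟩
      simp only [Function.comp_apply, Prod.swap, u, haug, pushVec_smul, basis_apply]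
      simp [hs]
    rw [heq]
    exact h2.comp Prod.swap Prod.swap_injective
  rw [linearIndependent_iff] at hu ⊢
  intro a ha
  rw [← hψφ a, hu (φ ι a) (by rw [← hcomb, ha, map_zero]), map_zero]

/-! ### Quotients by the rational derived series -/

/-- The three properties of a group `G` which make linear algebra over `ℚ[G]` behave as over a field
and control it by augmentation. -/
structure IsTame (G : Type u) [Group G] : Prop where
  strebel : StrebelProperty G
  uniqueProds : UniqueProds G
  folner : FolnerCondition G

lemma isTame_of_comm_of_torsionFree (G : Type u) [Group G] (hcomm : ∀ a b : G, a * b = b * a)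
    (htf : ∀ (a : G) (n : ℕ), n ≠ 0 → a ^ n = 1 → a = 1) : IsTame G := by
  let _ : CommGroup G := { ‹Group G› with mul_comm := hcomm }
  have : IsMulTorsionFree G := ⟨fun n hn a b hab => by
    have : (a / b) ^ n = 1 := by rw [div_pow, div_eq_one]; exact hab
    exact div_eq_one.mp (htf _ n hn this)⟩
  exact ⟨strebelProperty_of_torsionFree G, uniqueProds_of_torsionFree G, folnerCondition_of_comm G⟩

lemma IsTame.of_extension {G Q : Type u} [Group G] [Group Q] (f : G →* Q)
    (hf : Function.Surjective f) (hN : IsTame f.ker) (hQ : IsTame Q) : IsTame G :=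
  ⟨strebelProperty_of_extension f hf hN.strebel hQ.strebel,
    uniqueProds_of_extension f hN.uniqueProds hQ.uniqueProds,
    folnerCondition_of_extension f hf hN.folner hQ.folner⟩

/-- The rational derived series: each term consists of the elements of the preceding one that are
torsion in its abelianization. Its successive quotients are torsion-free abelian. -/
def rationalDerivedSeries (G : Type*) [Group G] : ℕ → Subgroup G
  | 0 => ⊤
  | k + 1 => ((CommGroup.torsion (Abelianization (rationalDerivedSeries G k))).comap
      Abelianization.of).map (rationalDerivedSeries G k).subtype

lemma abelianization_of_eq_one_iff {G : Type*} [Group G] {H : Subgroup G} (x : H) :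
    Abelianization.of x = 1 ↔ (x : G) ∈ ⁅H, H⁆ := by
  rw [← MonoidHom.mem_ker, Abelianization.ker_of, ← H.map_subtype_commutator,
    ← Subgroup.mem_map_iff_mem H.subtype_injective, H.coe_subtype]

lemma mem_rationalDerivedSeries_succ {G : Type*} [Group G] {k : ℕ} {x : G} :
    x ∈ rationalDerivedSeries G (k + 1) ↔ x ∈ rationalDerivedSeries G k ∧
      ∃ m, 0 < m ∧ x ^ m ∈ ⁅rationalDerivedSeries G k, rationalDerivedSeries G k⁆ := by
  simp only [rationalDerivedSeries, Subgroup.mem_map, Subgroup.mem_comap]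
  constructor
  · rintro ⟨y, hy, rfl⟩
    refine ⟨y.2, ?_⟩
    obtain ⟨m, hm, h⟩ := isOfFinOrder_iff_pow_eq_one.mp hy
    exact ⟨m, hm, by rwa [← map_pow, abelianization_of_eq_one_iff] at h⟩
  · rintro ⟨hx, m, hm, h⟩
    refine ⟨⟨x, hx⟩, isOfFinOrder_iff_pow_eq_one.mpr ⟨m, hm, ?_⟩, rfl⟩
    rwa [← map_pow, abelianization_of_eq_one_iff]

instance rationalDerivedSeries_normal {G : Type*} [Group G] (k : ℕ) :
    (rationalDerivedSeries G k).Normal := by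
  induction k with
  | zero => exact inferInstanceAs (⊤ : Subgroup G).Normal
  | succ k ih =>
    refine ⟨fun x hx g => ?_⟩
    rw [mem_rationalDerivedSeries_succ] at hx ⊢
    obtain ⟨h1, m, hm, h2⟩ := hx
    refine ⟨ih.conj_mem _ h1 g, m, hm, ?_⟩
    rw [conj_pow]
    exact Subgroup.Normal.conj_mem inferInstance _ h2 g

lemma rationalDerivedSeries_succ_le {G : Type*} [Group G] (k : ℕ) :
    rationalDerivedSeries G (k + 1) ≤ rationalDerivedSeries G k :=
  fun _ hx => (mem_rationalDerivedSeries_succ.mp hx).1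

lemma commutator_le_rationalDerivedSeries_succ {G : Type*} [Group G] (k : ℕ) :
    ⁅rationalDerivedSeries G k, rationalDerivedSeries G k⁆ ≤ rationalDerivedSeries G (k + 1) :=
  fun x hx => mem_rationalDerivedSeries_succ.mpr
    ⟨Subgroup.commutator_le_left _ _ hx, 1, one_pos, by simpa using hx⟩

lemma derivedSeries_le_rationalDerivedSeries {G : Type*} [Group G] (k : ℕ) :
    derivedSeries G k ≤ rationalDerivedSeries G k := by
  induction k with
  | zero => exact le_rfl
  | succ k ih =>
    exact (Subgroup.commutator_mono ih ih).trans (commutator_le_rationalDerivedSeries_succ k)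

lemma isTame_quotient_rationalDerivedSeries (G : Type u) [Group G] (k : ℕ) :
    IsTame (G ⧸ rationalDerivedSeries G k) := by
  induction k with
  | zero =>
    have : Subsingleton (G ⧸ rationalDerivedSeries G 0) := QuotientGroup.subsingleton_quotient_top
    exact isTame_of_comm_of_torsionFree _ (fun _ _ => Subsingleton.elim _ _)
      fun _ _ _ _ => Subsingleton.elim _ _
  | succ k ih =>
    let f : G ⧸ rationalDerivedSeries G (k + 1) →* G ⧸ rationalDerivedSeries G k :=
      QuotientGroup.map _ _ (MonoidHom.id G) (rationalDerivedSeries_succ_le k)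
    have hf : Function.Surjective f := by
      intro x
      obtain ⟨g, rfl⟩ := QuotientGroup.mk_surjective x
      exact ⟨g, rfl⟩
    have hker : ∀ g : G, f (g : G ⧸ rationalDerivedSeries G (k + 1)) = 1 →
        g ∈ rationalDerivedSeries G k := fun g hg => (QuotientGroup.eq_one_iff g).mp hg
    refine IsTame.of_extension f hf (isTame_of_comm_of_torsionFree _ ?_ ?_) ih
    · rintro ⟨a, ha⟩ ⟨b, hb⟩
      obtain ⟨a, rfl⟩ := QuotientGroup.mk_surjective a
      obtain ⟨b, rfl⟩ := QuotientGroup.mk_surjective b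
      have := commutator_le_rationalDerivedSeries_succ k
        (Subgroup.commutator_mem_commutator (hker a ha) (hker b hb))
      rw [← QuotientGroup.eq_one_iff] at this
      refine Subtype.ext ?_
      simpa [commutatorElement_def, mul_inv_eq_one, mul_inv_eq_iff_eq_mul] using this
    · rintro ⟨a, ha⟩ n hn h
      obtain ⟨a, rfl⟩ := QuotientGroup.mk_surjective a
      have han : a ^ n ∈ rationalDerivedSeries G (k + 1) :=
        (QuotientGroup.eq_one_iff _).mp (congrArg Subtype.val h)
      obtain ⟨-, m, hm, h2⟩ := mem_rationalDerivedSeries_succ.mp han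
      refine Subtype.ext ((QuotientGroup.eq_one_iff _).mpr (mem_rationalDerivedSeries_succ.mpr
        ⟨hker a ha, n * m, by positivity, ?_⟩))
      rwa [pow_mul]

/-! ### Crossed homomorphisms and the Magnus embedding -/

/-- A crossed homomorphism (derivation) `D : G → M`, where `G` acts on the `R`-module `M` through
`ρ : G → R`. -/
def IsCrossedHom {G R M : Type*} [Group G] [Ring R] [AddCommGroup M] [Module R M]
    (ρ : G →* R) (D : G → M) : Prop :=
  ∀ u v, D (u * v) = D u + ρ u • D v

namespace IsCrossedHom

variable {G R M : Type*} [Group G] [Ring R] [AddCommGroup M] [Module R M]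
    {ρ : G →* R} {D : G → M}

lemma apply_one (h : IsCrossedHom ρ D) : D 1 = 0 := by
  simpa using h 1 1

lemma apply_inv (h : IsCrossedHom ρ D) (u : G) : D u⁻¹ = -(ρ u⁻¹ • D u) := by
  have := h u⁻¹ u
  rw [inv_mul_cancel, h.apply_one] at this
  exact eq_neg_of_add_eq_zero_left this.symm

lemma apply_conj (h : IsCrossedHom ρ D) (w : G) {r : G} (hr : ρ r = 1) :
    D (w * r * w⁻¹) = ρ w • D r := by
  rw [h, h, h.apply_inv, map_mul, hr, mul_one, smul_neg, smul_smul, ← map_mul, mul_inv_cancel,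
    map_one, one_smul]
  abel

lemma apply_pow (h : IsCrossedHom ρ D) {u : G} (hu : ρ u = 1) (m : ℕ) : D (u ^ m) = m • D u := by
  induction m with
  | zero => simp [h.apply_one]
  | succ m ih => rw [pow_succ, h, ih, map_pow, hu, one_pow, one_smul, succ_nsmul]

/-- A crossed homomorphism is a homomorphism on a subgroup that acts trivially. -/
def toHom (h : IsCrossedHom ρ D) (N : Subgroup G) (hN : ∀ u ∈ N, ρ u = 1) :
    N →* Multiplicative M where
  toFun u := Multiplicative.ofAdd (D u)
  map_one' := by simp [h.apply_one]
  map_mul' u v := by simp [h _ _, hN _ u.2]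

lemma apply_eq_zero_of_mem_commutator (h : IsCrossedHom ρ D) {N : Subgroup G}
    (hN : ∀ u ∈ N, ρ u = 1) {c : G} (hc : c ∈ ⁅N, N⁆) : D c = 0 := by
  rw [← N.map_subtype_commutator] at hc
  obtain ⟨c, hc, rfl⟩ := hc
  exact Abelianization.commutator_subset_ker (h.toHom N hN) hc

lemma map {M' : Type*} [AddCommGroup M'] {R' : Type*} [Ring R'] [Module R' M']
    (h : IsCrossedHom ρ D) (ρ' : G →* R') (L : M →+ M') (hL : ∀ u m, L (ρ u • m) = ρ' u • L m) :
    IsCrossedHom ρ' (fun u => L (D u)) := fun u v => by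
  simp only [h u v, map_add, hL]

lemma ext_freeGroup {X : Type*} {ρ : FreeGroup X →* R} {D D' : FreeGroup X → M}
    (h : IsCrossedHom ρ D) (h' : IsCrossedHom ρ D')
    (H : ∀ x, D (FreeGroup.of x) = D' (FreeGroup.of x)) (w : FreeGroup X) : D w = D' w := by
  induction w using FreeGroup.induction_on with
  | C1 => rw [h.apply_one, h'.apply_one]
  | of x => exact H x
  | inv_of x hx => rw [h.apply_inv, h'.apply_inv, hx]
  | mul u v hu hv => rw [h, h', hu, hv]

end IsCrossedHom

/-- Fox calculus: a crossed homomorphism on a free group can be prescribed on the generators. -/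
lemma exists_isCrossedHom {X R M : Type*} [Ring R] [AddCommGroup M] [Module R M]
    (ρ : FreeGroup X →* R) (e : X → M) :
    ∃ D : FreeGroup X → M, IsCrossedHom ρ D ∧ ∀ x, D (FreeGroup.of x) = e x := by
  -- `w` acts on `M` by the affine transformation `m ↦ D w + ρ w • m`
  let A : FreeGroup X →* Equiv.Perm M := FreeGroup.lift fun x =>
    { toFun := fun m => e x + ρ (FreeGroup.of x) • m
      invFun := fun m => ρ (FreeGroup.of x)⁻¹ • (m - e x)
      left_inv := fun m => by simp [smul_smul, ← map_mul]
      right_inv := fun m => by simp [smul_smul, ← map_mul] }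
  have hA : ∀ w m, A w m = A w 0 + ρ w • m := by
    intro w
    induction w using FreeGroup.induction_on with
    | C1 => simp
    | of x => intro m; simp [A]
    | inv_of x hx =>
      intro m
      have hcancel : ∀ m, A (FreeGroup.of x) (A (FreeGroup.of x)⁻¹ m) = m := fun m => by
        rw [← Equiv.Perm.mul_apply, ← map_mul, mul_inv_cancel, map_one, Equiv.Perm.one_apply]
      apply (A (FreeGroup.of x)).injective
      rw [hcancel, hx, smul_add, ← add_assoc, ← hx, hcancel, smul_smul, ← map_mul]
      simp
    | mul u v hu hv =>
      intro m
      rw [map_mul, Equiv.Perm.mul_apply, Equiv.Perm.mul_apply, hv, hu, hu (A v 0), map_mul,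
        smul_add, mul_smul, add_assoc]
  refine ⟨fun w => A w 0, fun u v => ?_, fun x => ?_⟩
  · simp only [map_mul, Equiv.Perm.mul_apply, hA u (A v 0)]
  · simp [A]

/-- Faithfulness of the Magnus embedding, with integral coefficients: an element of `ker ρ` with
vanishing Fox derivatives is trivial in the abelianization of `ker ρ`. The class of the element is
recovered from its Fox derivatives by sending `g` times the `x`-th basis vector to the
Reidemeister-Schreier generator of `ker ρ` given by `g` and `x`. -/
lemma mem_commutator_of_fox_int {X Γ : Type*} [Group Γ] (ρ : FreeGroup X →* Γ)
    {D : FreeGroup X → X →₀ MonoidAlgebra ℤ Γ} (hD : IsCrossedHom ((of ℤ Γ).comp ρ) D)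
    (hof : ∀ x, D (FreeGroup.of x) = Finsupp.single x 1) {w : FreeGroup X}
    (hw : w ∈ ρ.ker) (h0 : D w = 0) : w ∈ ⁅ρ.ker, ρ.ker⁆ := by
  classical
  obtain ⟨s, hs⟩ : ∃ s : Γ → FreeGroup X, ∀ u, ρ (s (ρ u)) = ρ u :=
    ⟨Function.invFun ρ, fun u => Function.invFun_eq ⟨u, rfl⟩⟩
  let κ : FreeGroup X → Additive (Abelianization ρ.ker) := fun w =>
    if h : w ∈ ρ.ker then Additive.ofMul (Abelianization.of ⟨w, h⟩) else 0
  have hκ : ∀ u ∈ ρ.ker, ∀ v ∈ ρ.ker, κ (u * v) = κ u + κ v := by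
    intro u hu v hv
    simp only [κ, dif_pos hu, dif_pos hv, dif_pos (mul_mem hu hv)]
    rw [← ofMul_mul, ← map_mul]
    rfl
  -- For `g` in the range of `ρ` this is the class of an element of `ker ρ`; only such `g` matter.
  let c : Γ → FreeGroup X → Additive (Abelianization ρ.ker) := fun g w =>
    κ (s g * w * (s (g * ρ w))⁻¹)
  have hmem : ∀ u w, s (ρ u) * w * (s (ρ u * ρ w))⁻¹ ∈ ρ.ker := by
    intro u w
    rw [← map_mul, MonoidHom.mem_ker, map_mul, map_mul, map_inv, hs, hs, map_mul]
    group
  have hc : ∀ u v w, c (ρ u) (v * w) = c (ρ u) v + c (ρ (u * v)) w := by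
    intro u v w
    have h2 := hmem (u * v) w
    rw [map_mul] at h2
    simp only [c, map_mul]
    rw [← hκ _ (hmem u v) _ h2]
    congr 1
    simp only [mul_assoc, inv_mul_cancel_left]
  have hc1 : ∀ u, c (ρ u) 1 = 0 := fun u => by
    have := hc u 1 1
    simpa using this
  let θ : (X →₀ MonoidAlgebra ℤ Γ) →+ Additive (Abelianization ρ.ker) :=
    Finsupp.liftAddHom fun x => (Finsupp.liftAddHom fun g =>
      zmultiplesHom _ (c g (FreeGroup.of x))).comp coeffAddEquiv.toAddMonoidHom
  have hθ : ∀ v u, θ ((of ℤ Γ) (ρ u) • D v) = c (ρ u) v := by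
    intro v
    induction v using FreeGroup.induction_on with
    | C1 => intro u; rw [hD.apply_one, smul_zero, map_zero, hc1]
    | of x => intro u; simp [hof, θ]
    | inv_of x hx =>
      intro u
      have h1 := hc u (FreeGroup.of x)⁻¹ (FreeGroup.of x)
      rw [inv_mul_cancel, hc1] at h1
      rw [hD.apply_inv, smul_neg, map_neg, smul_smul, MonoidHom.comp_apply, ← map_mul, ← map_mul,
        hx]
      exact neg_eq_of_add_eq_zero_left h1.symm
    | mul v w hv hw =>
      intro u
      rw [hD, smul_add, map_add, hv, smul_smul, MonoidHom.comp_apply, ← map_mul, ← map_mul, hw, hc]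
  have h1 := hθ w 1
  rw [h0, smul_zero, map_zero, map_one] at h1
  have hw' : ρ w = 1 := hw
  have hm := hmem 1 w
  rw [map_one, hw', mul_one] at hm
  simp only [c, hw', mul_one, κ, dif_pos hm] at h1
  have h2 := (abelianization_of_eq_one_iff _).mp (ofMul_eq_zero.mp h1.symm)
  have := Subgroup.Normal.conj_mem (inferInstance : (⁅ρ.ker, ρ.ker⁆).Normal) _ h2 (s 1)⁻¹
  simpa [mul_assoc] using this

/-- The same with rational coefficients, which contain the integral ones. -/
lemma mem_commutator_of_fox {X Γ : Type*} [Group Γ] (ρ : FreeGroup X →* Γ)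
    {D : FreeGroup X → X →₀ MonoidAlgebra ℚ Γ} (hD : IsCrossedHom ((of ℚ Γ).comp ρ) D)
    (hof : ∀ x, D (FreeGroup.of x) = Finsupp.single x 1) {w : FreeGroup X}
    (hw : w ∈ ρ.ker) (h0 : D w = 0) : w ∈ ⁅ρ.ker, ρ.ker⁆ := by
  obtain ⟨E, hE, hEof⟩ := exists_isCrossedHom ((of ℤ Γ).comp ρ)
    fun x : X => Finsupp.single x (1 : MonoidAlgebra ℤ Γ)
  let j : MonoidAlgebra ℤ Γ →+* MonoidAlgebra ℚ Γ := mapRingHom Γ (Int.castRingHom ℚ)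
  have hj : Function.Injective j := map_injective _ Int.cast_injective
  let J : (X →₀ MonoidAlgebra ℤ Γ) →+ (X →₀ MonoidAlgebra ℚ Γ) :=
    Finsupp.mapRange.addMonoidHom j.toAddMonoidHom
  have hJ : Function.Injective J := Finsupp.mapRange_injective _ (map_zero j) hj
  have hJE := hE.map ((of ℚ Γ).comp ρ) J fun u m => by
    ext1 x
    simp [J, j]
  have hDE := hJE.ext_freeGroup hD (fun x => by simp [J, hEof, hof]) w
  refine mem_commutator_of_fox_int ρ hE hEof hw (hJ ?_)
  rw [map_zero, ← h0]
  exact hDE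

/-! ### Independence modulo relations -/

/-- Over the group ring of an amenable group, every vector of a free module of rank `k` has a nonzero
multiple in the span of `k` given independent vectors. -/
lemma exists_smul_add_sum_eq_zero {Γ : Type*} [Group Γ] (hΓ : FolnerCondition Γ) {κ : Type*}
    [Fintype κ] {z : κ → κ →₀ MonoidAlgebra ℚ Γ} (hz : LinearIndependent (MonoidAlgebra ℚ Γ) z)
    (l : κ →₀ MonoidAlgebra ℚ Γ) :
    ∃ (β : MonoidAlgebra ℚ Γ) (g : κ → MonoidAlgebra ℚ Γ),
      β ≠ 0 ∧ β • l + ∑ i, g i • z i = 0 := by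
  have hdep := not_linearIndependent_of_folnerCondition hΓ (ι := Option κ) (κ := κ)
    (by rw [Fintype.card_option]; omega) fun o => o.elim l z
  obtain ⟨g, hg, o, ho⟩ := Fintype.not_linearIndependent_iff.mp hdep
  rw [Fintype.sum_option] at hg
  refine ⟨g none, fun i => g (some i), fun h0 => ?_, hg⟩
  simp only [Option.elim, h0, zero_smul, zero_add] at hg
  have := Fintype.linearIndependent_iff.mp hz _ hg
  cases o with
  | none => exact ho h0
  | some i => exact ho (this i)

/-- Linear algebra of a presentation matrix `d` over the group ring of a tame group. If the vectors
`e` are independent modulo `d` after augmentation, and all rational relations between the augmented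
`d` lift to relations between the `d`, then the `e` are independent modulo `d`. -/
theorem eq_zero_of_mem_span_relations {Γ : Type u} [Group Γ] (hΓ : IsTame Γ)
    {ι S X : Type u} [Fintype ι] (e : S → X →₀ MonoidAlgebra ℚ Γ)
    (d : ι → X →₀ MonoidAlgebra ℚ Γ)
    (he : ∀ μ : S →₀ ℚ, Finsupp.linearCombination ℚ (fun a => augVec X Γ (e a)) μ ∈
      Submodule.span ℚ (Set.range fun i => augVec X Γ (d i)) → μ = 0)
    (hd : ∀ c : ι →₀ ℚ, Finsupp.linearCombination ℚ (fun i => augVec X Γ (d i)) c = 0 →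
      ∃ l : ι →₀ MonoidAlgebra ℚ Γ, Finsupp.linearCombination (MonoidAlgebra ℚ Γ) d l = 0 ∧
        augVec ι Γ l = c)
    (μ : S →₀ MonoidAlgebra ℚ Γ)
    (hμ : Finsupp.linearCombination (MonoidAlgebra ℚ Γ) e μ ∈
      Submodule.span (MonoidAlgebra ℚ Γ) (Set.range d)) : μ = 0 := by
  classical
  have := hΓ.uniqueProds
  obtain ⟨J, -, -, hJspan, hJ⟩ := exists_linearIndepOn_extension (K := ℚ)
    (v := fun i => augVec X Γ (d i)) (s := ∅) (t := Set.univ) (linearIndepOn_empty _ _)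
    (Set.subset_univ _)
  -- The vectors outside `J` are redundant after augmentation; `z` lifts these relations.
  have hz : ∀ i : ↥(Jᶜ), ∃ z : ι →₀ MonoidAlgebra ℚ Γ,
      Finsupp.linearCombination (MonoidAlgebra ℚ Γ) d z = 0 ∧
      ∀ k : ↥(Jᶜ), augmentation Γ (z k) = (Finsupp.single i 1 : ↥(Jᶜ) →₀ ℚ) k := by
    intro i
    obtain ⟨c, hc, hci⟩ := (Finsupp.mem_span_image_iff_linearCombination ℚ).mp
      (hJspan ⟨(i : ι), Set.mem_univ _, rfl⟩)
    obtain ⟨z, hz0, hz⟩ := hd (Finsupp.single (i : ι) 1 - c) (by simp [hci])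
    refine ⟨z, hz0, fun k => ?_⟩
    have hck : c k = 0 := by
      by_contra h
      exact k.2 (hc (Finsupp.mem_support_iff.mpr h))
    have := DFunLike.congr_fun hz (k : ι)
    simpa [augVec, hck, Finsupp.single_apply, Subtype.ext_iff] using this
  choose z hz0 hz using hz
  have hT : LinearIndependent (MonoidAlgebra ℚ Γ) (Sum.elim e fun j : J => d j) := by
    refine hΓ.strebel _ _ _ ?_
    have heq : (fun i => augVec X Γ (Sum.elim e (fun j : J => d j) i)) =
        Sum.elim (fun a => augVec X Γ (e a)) fun j : J => augVec X Γ (d j) := by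
      ext1 i; cases i <;> rfl
    rw [heq]
    refine LinearIndependent.sum_type ?_ hJ ?_
    · rw [linearIndependent_iff]
      exact fun μ h0 => he μ (h0 ▸ zero_mem _)
    · rw [Submodule.disjoint_def]
      intro x hx hx'
      obtain ⟨μ, rfl⟩ := (Finsupp.mem_span_range_iff_exists_finsupp).mp hx
      have := he μ (Submodule.span_mono (by rintro _ ⟨j, rfl⟩; exact ⟨j, rfl⟩) hx')
      rw [this]; simp
  let res : (ι →₀ MonoidAlgebra ℚ Γ) →ₗ[MonoidAlgebra ℚ Γ] (↥(Jᶜ) →₀ MonoidAlgebra ℚ Γ) :=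
    Finsupp.lcomapDomain Subtype.val Subtype.val_injective
  have hres : ∀ v k, res v k = v (k : ι) := fun v k => rfl
  have hzli : LinearIndependent (MonoidAlgebra ℚ Γ) fun i => res (z i) := by
    refine hΓ.strebel _ _ _ ?_
    have heq : (fun i => augVec _ Γ (res (z i))) = fun i => Finsupp.single i 1 := by
      ext1 i; ext1 k
      rw [← hz i k]
      simp [augVec, hres]
    rw [heq]
    exact Finsupp.linearIndependent_single_one ℚ _
  obtain ⟨l, hl⟩ := (Finsupp.mem_span_range_iff_exists_finsupp).mp hμ
  replace hl : Finsupp.linearCombination (MonoidAlgebra ℚ Γ) d l =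
      Finsupp.linearCombination (MonoidAlgebra ℚ Γ) e μ := hl
  -- Subtracting multiples of the `z i` from a multiple of `l`, all coordinates outside `J` vanish.
  obtain ⟨β, g, hβ, hg⟩ := exists_smul_add_sum_eq_zero hΓ.folner hzli (res l)
  set ν := β • l + ∑ i, g i • z i with hν
  have hresν : res ν = 0 := by rw [← hg]; simp [hν]
  have hdν : Finsupp.linearCombination (MonoidAlgebra ℚ Γ) d ν =
      Finsupp.linearCombination (MonoidAlgebra ℚ Γ) e (β • μ) := by
    simp [hν, hz0, hl]
  have hmem : Finsupp.linearCombination (MonoidAlgebra ℚ Γ) d ν ∈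
      Submodule.span (MonoidAlgebra ℚ Γ) (d '' J) := by
    refine (Finsupp.mem_span_image_iff_linearCombination _).mpr ⟨ν, ?_, rfl⟩
    intro i hi
    by_contra hiJ
    exact (Finsupp.mem_support_iff.mp hi) (DFunLike.congr_fun hresν (⟨i, hiJ⟩ : ↥(Jᶜ)))
  have heli : LinearIndependent (MonoidAlgebra ℚ Γ) e :=
    hT.comp Sum.inl Sum.inl_injective
  have hdisj : Disjoint (Submodule.span (MonoidAlgebra ℚ Γ) (Set.range e))
      (Submodule.span (MonoidAlgebra ℚ Γ) (d '' J)) := by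
    have := (linearIndependent_sum.mp hT).2.2
    rwa [Sum.elim_comp_inl, Sum.elim_comp_inr, ← Set.image_eq_range] at this
  rw [hdν] at hmem
  have hmem' : Finsupp.linearCombination (MonoidAlgebra ℚ Γ) e (β • μ) ∈
      Submodule.span (MonoidAlgebra ℚ Γ) (Set.range e) := by
    rw [← Finsupp.range_linearCombination]
    exact LinearMap.mem_range_self _ _
  have h0 := Submodule.disjoint_def.mp hdisj _ hmem' hmem
  have h1 := linearIndependent_iff.mp heli _ h0
  ext1 a
  have h2 := DFunLike.congr_fun h1 a
  rw [Finsupp.smul_apply, smul_eq_mul, Finsupp.zero_apply] at h2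
  exact (mul_eq_zero.mp h2).resolve_left hβ

/-! ### Second homology and extension of homomorphisms -/

/-- The abelian group `M` with trivial action of `G`. -/
abbrev trivialRep (G : Type u) [Group G] (M : Type) [AddCommGroup M] : Rep (ULift.{u} ℤ) G :=
  Rep.trivial (ULift.{u} ℤ) G (ULift.{u} M)

/-- The map `coeffMap` on classes of inhomogeneous cycles. -/
lemma coeffMap_H2π {G : Type u} [Group G] {M M' : Type} [AddCommGroup M] [AddCommGroup M']
    (f : M →+ M') (z : cycles₂ (trivialRep G M)) :
    ∃ z' : cycles₂ (trivialRep G M'), coeffMap G f 2 (H2π _ z) = H2π _ z' ∧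
      (z' : G × G →₀ ULift.{u} M') = Finsupp.mapRange.addMonoidHom
        (coeffLinear.{u} f).toAddMonoidHom (z : G × G →₀ ULift.{u} M) := by
  refine ⟨mapCycles₂ (A := trivialRep G M) (B := trivialRep G M') (MonoidHom.id G)
    ((Rep.trivialFunctor (ULift.{u} ℤ) G).map (ModuleCat.ofHom (coeffLinear.{u} f))) z,
    H2π_comp_map_apply (A := trivialRep G M) (B := trivialRep G M') (MonoidHom.id G)
    ((Rep.trivialFunctor (ULift.{u} ℤ) G).map (ModuleCat.ofHom (coeffLinear.{u} f))) z, ?_⟩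
  refine (coe_mapCycles₂ (A := trivialRep G M) (B := trivialRep G M') (MonoidHom.id G)
    ((Rep.trivialFunctor (ULift.{u} ℤ) G).map (ModuleCat.ofHom (coeffLinear.{u} f))) z).trans ?_
  change Finsupp.mapRange (coeffLinear.{u} f) (map_zero _) (Finsupp.mapDomain id _) = _
  rw [Finsupp.mapDomain_id]
  rfl

/-- The map `inducedMap` on classes of inhomogeneous cycles. -/
lemma inducedMap_H2π {G G' : Type u} [Group G] [Group G'] (φ : G →* G') (M : Type)
    [AddCommGroup M] (z : cycles₂ (trivialRep G M)) :
    ∃ z' : cycles₂ (trivialRep G' M), inducedMap φ M 2 (H2π _ z) = H2π _ z' ∧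
      (z' : G' × G' →₀ ULift.{u} M) = Finsupp.mapDomain (Prod.map φ φ)
        (z : G × G →₀ ULift.{u} M) := by
  refine ⟨mapCycles₂ (B := trivialRep G' M) φ (𝟙 (Rep.res φ (trivialRep G' M))) z,
    H2π_comp_map_apply (B := trivialRep G' M) φ (𝟙 (Rep.res φ (trivialRep G' M))) z, ?_⟩
  refine (coe_mapCycles₂ (B := trivialRep G' M) φ (𝟙 (Rep.res φ (trivialRep G' M))) z).trans ?_
  change Finsupp.mapRange id rfl (Finsupp.mapDomain _ _) = _
  rw [Finsupp.mapRange_id]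

section Cochains

variable {B : Type u} [Group B] {V : Type*} [AddCommGroup V] [Module ℚ V]

/-- The additive map from chains with rational coefficients to a rational vector space that sends
the simplex `i` to `c i`. -/
noncomputable def evalChain {ι : Type u} (c : ι → V) : (ι →₀ ULift.{u} ℚ) →+ V :=
  Finsupp.liftAddHom fun i =>
    { toFun := fun q => q.down • c i
      map_zero' := zero_smul _ _
      map_add' := fun _ _ => add_smul _ _ _ }

@[simp] lemma evalChain_single {ι : Type u} (c : ι → V) (i : ι) (q : ULift.{u} ℚ) :
    evalChain c (Finsupp.single i q) = q.down • c i := by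
  simp [evalChain]

/-- A `2`-cocycle vanishes on boundaries. -/
lemma evalChain_boundary (c : B × B → V)
    (hc : ∀ g h k, c (h, k) - c (g * h, k) + c (g, h * k) - c (g, h) = 0)
    {x : B × B →₀ ULift.{u} ℚ} (hx : x ∈ boundaries₂ (trivialRep B ℚ)) : evalChain c x = 0 := by
  obtain ⟨y, rfl⟩ := hx
  refine DFunLike.congr_fun (f := (evalChain c).comp (d₃₂ (trivialRep B ℚ)).hom.toAddMonoidHom)
    (g := 0) (Finsupp.addHom_ext fun p q => ?_) y
  have h : ((d₃₂ (trivialRep B ℚ)).hom (Finsupp.single p q) : B × B →₀ ULift.{u} ℚ) =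
      Finsupp.single (p.2.1, p.2.2) q - Finsupp.single (p.1 * p.2.1, p.2.2) q +
      Finsupp.single (p.1, p.2.1 * p.2.2) q - Finsupp.single (p.1, p.2.1) q :=
    d₃₂_single (A := trivialRep B ℚ) p q
  refine (congrArg (evalChain c) h).trans ?_
  simp only [map_sub, map_add, evalChain_single, ← smul_sub, ← smul_add]
  rw [hc, smul_zero]
  rfl

lemma d₂₁_trivialRep_single {G : Type u} [Group G] {M : Type} [AddCommGroup M] (p : G × G)
    (m : ULift.{u} M) :
    ((d₂₁ (trivialRep G M)).hom (Finsupp.single p m) : G →₀ ULift.{u} M) =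
      Finsupp.single p.2 m - Finsupp.single (p.1 * p.2) m + Finsupp.single p.1 m :=
  d₂₁_single (A := trivialRep G M) p m

/-- A function on `B × B` that restricts to a coboundary on a subgroup vanishes on the integral cycles
of this subgroup. -/
lemma evalChain_surface (c : B × B → V) (M : Subgroup B) (f : M → V)
    (hc : ∀ g h : M, c (g, h) = f h - f (g * h) + f g)
    (z : cycles₂ (trivialRep M ℤ)) :
    evalChain c (Finsupp.mapRange.addMonoidHom
      (coeffLinear.{u} (Int.castAddHom ℚ)).toAddMonoidHom
      (Finsupp.mapDomain (Prod.map M.subtype M.subtype) (z : M × M →₀ ULift.{u} ℤ))) = 0 := by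
  let Ev : (M →₀ ULift.{u} ℤ) →+ V := Finsupp.liftAddHom fun g =>
    { toFun := fun n => n.down • f g
      map_zero' := zero_smul _ _
      map_add' := fun _ _ => add_smul _ _ _ }
  have hEv : ∀ g n, Ev (Finsupp.single g n) = n.down • f g := fun g n => by simp [Ev]
  have h := DFunLike.congr_fun (F := (M × M →₀ ULift.{u} ℤ) →+ V)
    (f := ((evalChain c).comp (Finsupp.mapRange.addMonoidHom
      (coeffLinear.{u} (Int.castAddHom ℚ)).toAddMonoidHom)).comp
      (Finsupp.mapDomain.addMonoidHom (Prod.map M.subtype M.subtype)))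
    (g := Ev.comp (d₂₁ (trivialRep M ℤ)).hom.toAddMonoidHom)
    (Finsupp.addHom_ext fun p n => ?_) (z : M × M →₀ ULift.{u} ℤ)
  · refine h.trans ?_
    have hz : (d₂₁ (trivialRep M ℤ)).hom (z : M × M →₀ ULift.{u} ℤ) = 0 := z.2
    exact (congrArg Ev hz).trans (map_zero _)
  · refine Eq.trans ?_ (congrArg Ev (d₂₁_trivialRep_single p n)).symm
    simp only [map_sub, map_add, hEv, ← smul_sub, ← smul_add, ← hc]
    simp [coeffLinear, Int.cast_smul_eq_zsmul]
    rfl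

lemma evalChain_smul {ι : Type u} (c : ι → V) (q : ℚ) (x : ι →₀ ULift.{u} ℚ) :
    evalChain c (Finsupp.mapRange.addMonoidHom
      (coeffLinear.{u} (AddMonoidHom.mulLeft q)).toAddMonoidHom x) = q • evalChain c x := by
  induction x using Finsupp.induction_linear with
  | zero => simp
  | add x y hx hy => simp only [map_add, hx, hy, smul_add]
  | single i r => simp [coeffLinear, mul_smul]

/-- If `H_2(B; ℚ)` is spanned by classes from the subgroup `M`, then a `2`-cocycle on `B` that is a
coboundary on `M` vanishes on all cycles. -/
theorem evalChain_cycle_eq_zero (M : Subgroup B) (hM : rationalSurfaceSpan M = ⊤)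
    (c : B × B → V)
    (hc : ∀ g h k, c (h, k) - c (g * h, k) + c (g, h * k) - c (g, h) = 0)
    (f : M → V) (hf : ∀ g h : M, c (g, h) = f h - f (g * h) + f g)
    (z : cycles₂ (trivialRep B ℚ)) : evalChain c (z : B × B →₀ ULift.{u} ℚ) = 0 := by
  have key : ∀ x ∈ rationalSurfaceSpan M, ∃ z : cycles₂ (trivialRep B ℚ),
      H2π (trivialRep B ℚ) z = x ∧ evalChain c (z : B × B →₀ ULift.{u} ℚ) = 0 := by
    intro x hx
    induction hx using Submodule.span_induction with
    | mem x hx =>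
      obtain ⟨_, ⟨y, rfl⟩, rfl⟩ := hx
      induction y using H2_induction_on with
      | h y =>
        obtain ⟨z₁, hz₁, hz₁'⟩ := inducedMap_H2π M.subtype ℤ y
        obtain ⟨z₂, hz₂, hz₂'⟩ := coeffMap_H2π (Int.castAddHom ℚ) z₁
        refine ⟨z₂, (hz₂.symm.trans (congrArg _ hz₁.symm)), ?_⟩
        rw [hz₂', hz₁']
        exact evalChain_surface c M f hf y
    | zero => exact ⟨0, map_zero _, map_zero _⟩
    | add x y _ _ hx hy =>
      obtain ⟨z, rfl, hz⟩ := hx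
      obtain ⟨w, rfl, hw⟩ := hy
      refine ⟨z + w, map_add _ _ _, ?_⟩
      exact (map_add (evalChain c) _ _).trans (by rw [hz, hw, add_zero])
    | smul q x _ hx =>
      obtain ⟨z, rfl, hz⟩ := hx
      obtain ⟨w, hw, hw'⟩ := coeffMap_H2π (AddMonoidHom.mulLeft q) z
      exact ⟨w, hw.symm, by rw [hw', evalChain_smul, hz, smul_zero]⟩
  obtain ⟨w, hw, hw0⟩ := key (H2π (trivialRep B ℚ) z) (hM ▸ Submodule.mem_top)
  have hb := (H2π_eq_iff z w).mp hw.symm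
  have h1 := evalChain_boundary c hc hb
  exact (sub_eq_zero.mp ((map_sub (evalChain c) _ _).symm.trans h1)).trans hw0

lemma exists_comp_eq_of_ker_le {K U V W : Type*} [Field K] [AddCommGroup U] [AddCommGroup V]
    [AddCommGroup W] [Module K U] [Module K V] [Module K W] (f : U →ₗ[K] V) (g : U →ₗ[K] W)
    (h : LinearMap.ker f ≤ LinearMap.ker g) : ∃ p : V →ₗ[K] W, ∀ x, p (f x) = g x := by
  obtain ⟨p, hp⟩ := (((LinearMap.ker f).liftQ g h).comp
    f.quotKerEquivRange.symm.toLinearMap).exists_extend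
  refine ⟨p, fun x => ?_⟩
  have := LinearMap.congr_fun hp ⟨f x, x, rfl⟩
  simp only [LinearMap.comp_apply, Submodule.subtype_apply, LinearEquiv.coe_coe] at this
  rw [this]
  have h2 : (⟨f x, x, rfl⟩ : LinearMap.range f) = f.quotKerEquivRange (Submodule.Quotient.mk x) :=
    rfl
  rw [h2, LinearEquiv.symm_apply_apply]
  rfl

/-- A function that vanishes on all rational `2`-cycles is a coboundary. -/
lemma exists_eq_coboundary (c : B × B → V)
    (hc : ∀ z : cycles₂ (trivialRep B ℚ), evalChain c (z : B × B →₀ ULift.{u} ℚ) = 0) :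
    ∃ f : B → V, ∀ g h, c (g, h) = f h - f (g * h) + f g := by
  let δ : (B × B →₀ ℚ) →ₗ[ℚ] (B →₀ ℚ) := Finsupp.linearCombination ℚ fun p =>
    Finsupp.single p.2 1 - Finsupp.single (p.1 * p.2) 1 + Finsupp.single p.1 1
  let up : ℚ →+ ULift.{u} ℚ := AddEquiv.ulift.symm.toAddMonoidHom
  have hup : ∀ q, (up q).down = q := fun _ => rfl
  have hle : LinearMap.ker δ ≤ LinearMap.ker (Finsupp.linearCombination ℚ c) := by
    intro x hx
    have h1 := DFunLike.congr_fun (F := (B × B →₀ ℚ) →+ (B →₀ ULift.{u} ℚ))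
      (f := (d₂₁ (trivialRep B ℚ)).hom.toAddMonoidHom.comp (Finsupp.mapRange.addMonoidHom up))
      (g := (Finsupp.mapRange.addMonoidHom up).comp δ.toAddMonoidHom)
      (Finsupp.addHom_ext fun p q => by
        have h2 := d₂₁_trivialRep_single (M := ℚ) p (up q)
        have h3 : Finsupp.mapRange.addMonoidHom up (Finsupp.single p q) =
          Finsupp.single p (up q) := by simp
        refine (congrArg (d₂₁ (trivialRep B ℚ)).hom h3).trans (h2.trans ?_)
        change _ = Finsupp.mapRange.addMonoidHom up (δ _)
        simp only [δ, Finsupp.linearCombination_single, smul_add, smul_sub, Finsupp.smul_single,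
          smul_eq_mul, mul_one, map_add, map_sub]
        simp only [Finsupp.mapRange.addMonoidHom_apply, Finsupp.mapRange_single]) x
    have h2 : Finsupp.mapRange.addMonoidHom up x ∈ cycles₂ (trivialRep B ℚ) := by
      refine h1.trans ?_
      have hx' : δ x = 0 := hx
      exact (congrArg (Finsupp.mapRange.addMonoidHom up) hx').trans (map_zero _)
    have h3 := hc ⟨_, h2⟩
    have h4 := DFunLike.congr_fun (F := (B × B →₀ ℚ) →+ V)
      (f := (evalChain c).comp (Finsupp.mapRange.addMonoidHom up))
      (g := (Finsupp.linearCombination ℚ c).toAddMonoidHom)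
      (Finsupp.addHom_ext fun p q => by simp [hup]) x
    exact h4.symm.trans h3
  obtain ⟨p, hp⟩ := exists_comp_eq_of_ker_le δ _ hle
  refine ⟨fun g => p (Finsupp.single g 1), fun g h => ?_⟩
  have := hp (Finsupp.single (g, h) 1)
  simp only [δ, Finsupp.linearCombination_single, one_smul, map_add, map_sub] at this
  exact this.symm

/-- Let `F → B` be surjective with kernel `N`, and let `Λ` be an invariant homomorphism from `N` to a
rational vector space which extends additively to the preimage of a subgroup `M` of `B`. If
`H_2(B; ℚ)` is spanned by classes from `M`, then `Λ` extends to a homomorphism on `F`. Indeed the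
obstruction is the class of the factor set of the extension, pushed forward by `Λ`, in
`H^2(B; V) = Hom(H_2(B; ℚ), V)`, and this class is trivial on `M`. This is a form of Hopf's formula
that avoids commutator calculations. -/
theorem exists_hom_extending {F : Type*} [Group F] (q : F →* B) (hq : Function.Surjective q)
    (M : Subgroup B) (hM : rationalSurfaceSpan M = ⊤) (Λ : F → V)
    (hadd : ∀ u v, q u ∈ M → q v ∈ M → Λ (u * v) = Λ u + Λ v)
    (hconj : ∀ w r, q r = 1 → Λ (w * r * w⁻¹) = Λ r) :
    ∃ L : F →* Multiplicative V, ∀ r, q r = 1 → L r = Multiplicative.ofAdd (Λ r) := by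
  classical
  obtain ⟨σ, hσ, hσ1⟩ : ∃ σ : B → F, (∀ b, q (σ b) = b) ∧ σ 1 = 1 := by
    refine ⟨Function.update (Function.surjInv hq) 1 1, fun b => ?_, by simp⟩
    by_cases hb : b = 1
    · subst hb; simp
    · simp [Function.update_of_ne hb, Function.surjInv_eq]
  have hker : ∀ r s, q r = 1 → q s = 1 → Λ (r * s) = Λ r + Λ s := fun r s hr hs =>
    hadd r s (hr ▸ one_mem M) (hs ▸ one_mem M)
  have hΛ1 : Λ 1 = 0 := by simpa using hker 1 1 (map_one q) (map_one q)
  -- the factor set of the extension `F → B`, seen through `Λ`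
  let γ : B → B → F := fun g h => σ g * σ h * (σ (g * h))⁻¹
  have hγ : ∀ g h, q (γ g h) = 1 := fun g h => by simp [γ, hσ]
  let c : B × B → V := fun p => Λ (γ p.1 p.2)
  have hc : ∀ g h k, c (h, k) - c (g * h, k) + c (g, h * k) - c (g, h) = 0 := by
    intro g h k
    have h1 : γ g h * γ (g * h) k = (σ g * γ h k * (σ g)⁻¹) * γ g (h * k) := by
      simp only [γ, mul_assoc, inv_mul_cancel_left]
    have h2 := congrArg Λ h1
    rw [hker _ _ (hγ _ _) (hγ _ _), hker _ _ (by simp [hγ]) (hγ _ _), hconj _ _ (hγ _ _)] at h2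
    simp only [c]
    rw [← sub_self (Λ (γ g h) + Λ (γ (g * h) k))]
    nth_rewrite 1 [h2]
    abel
  have hf : ∀ g h : M, c (g, h) = Λ (σ h) - Λ (σ (g * h : M)) + Λ (σ g) := by
    intro g h
    have h1 : γ g h * σ (g * h : M) = σ g * σ h := by simp [γ]
    have h2 := congrArg Λ h1
    rw [hadd (γ g h) _ (by rw [hγ]; exact one_mem M) (by rw [hσ]; exact (g * h).2),
      hadd (σ g) (σ h) (by rw [hσ]; exact g.2) (by rw [hσ]; exact h.2)] at h2
    simp only [c]
    rw [eq_sub_of_add_eq h2]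
    abel
  -- Correct `Λ` by a cochain `f` whose coboundary is the factor set.
  obtain ⟨f, hf⟩ := exists_eq_coboundary c
    (evalChain_cycle_eq_zero M hM c hc (fun g => Λ (σ g)) hf)
  have hf1 : f 1 = 0 := by
    have := hf 1 1
    simpa [c, γ, hσ1, hΛ1] using this.symm
  have hmem : ∀ w, q (w * (σ (q w))⁻¹) = 1 := fun w => by simp [hσ]
  refine ⟨MonoidHom.mk' (fun w => Multiplicative.ofAdd (f (q w) + Λ (w * (σ (q w))⁻¹))) ?_, ?_⟩
  · intro v w
    rw [← ofAdd_add]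
    congr 1
    have h1 : v * w * (σ (q (v * w)))⁻¹ = (v * (σ (q v))⁻¹) *
        ((σ (q v) * (w * (σ (q w))⁻¹) * (σ (q v))⁻¹) * γ (q v) (q w)) := by
      simp only [γ, map_mul, mul_assoc, inv_mul_cancel_left]
    rw [h1, hker _ _ (hmem v) (by simp [hγ, hσ]), hker _ _ (by simp [hσ]) (hγ _ _),
      hconj _ _ (hmem w)]
    have h2 := hf (q v) (q w)
    simp only [c] at h2
    rw [h2, map_mul]
    abel
  · intro r hr
    simp [hr, hf1, hσ1]

lemma rationalClass_mul (g h : B) :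
    rationalClass B (g * h) = rationalClass B g + rationalClass B h := by
  simp only [rationalClass, map_mul, ofMul_mul, map_add, LinearMap.add_apply]

/-- The homomorphism `B → H_1(B; ℚ)`. -/
noncomputable def rationalClassHom (B : Type u) [Group B] :
    B →* Multiplicative (trivialHomology B ℚ 1) :=
  MonoidHom.mk' (fun g => Multiplicative.ofAdd (rationalClass B g)) fun g h => by
    rw [rationalClass_mul, ofAdd_add]

end Cochains

/-! ### Fox derivatives of a presentation -/

/-- A homomorphism from a free group to a rational vector space factors through the augmentation of
the Fox derivatives. -/
lemma exists_linear_of_hom {X Γ : Type u} [Group Γ] {ρ : FreeGroup X →* Γ}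
    {D : FreeGroup X → X →₀ MonoidAlgebra ℚ Γ} (hD : IsCrossedHom ((of ℚ Γ).comp ρ) D)
    (hof : ∀ x, D (FreeGroup.of x) = Finsupp.single x 1) {V : Type*} [AddCommGroup V]
    [Module ℚ V] (χ : FreeGroup X →* Multiplicative V) :
    ∃ L : (X →₀ ℚ) →ₗ[ℚ] V, ∀ w, L (augVec X Γ (D w)) = (χ w).toAdd := by
  let L : (X →₀ ℚ) →ₗ[ℚ] V :=
    Finsupp.linearCombination ℚ fun x => (χ (FreeGroup.of x)).toAdd
  have h1 : IsCrossedHom (1 : FreeGroup X →* ℚ) fun w => (L.comp (augVec X Γ)) (D w) :=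
    hD.map 1 (L.comp (augVec X Γ)).toAddMonoidHom fun u m => by simp [augVec_smul]
  have h2 : IsCrossedHom (1 : FreeGroup X →* ℚ) fun w => (χ w).toAdd := fun u v => by simp
  refine ⟨L, h1.ext_freeGroup h2 fun x => ?_⟩
  simp [hof, L]

lemma mem_span_of_mem_normalClosure {F R M : Type*} [Group F] [Ring R] [AddCommGroup M] [Module R M]
    {ρ : F →* R} {D : F → M} (hD : IsCrossedHom ρ D) (rels : Set F) (hρ : ∀ r ∈ rels, ρ r = 1)
    {r : F} (hr : r ∈ Subgroup.normalClosure rels) :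
    ρ r = 1 ∧ D r ∈ Submodule.span R (Set.range fun j : rels => D j) := by
  let N : Subgroup F :=
    { carrier := {r | ρ r = 1 ∧ D r ∈ Submodule.span R (Set.range fun j : rels => D j)}
      one_mem' := ⟨map_one ρ, by rw [hD.apply_one]; exact zero_mem _⟩
      mul_mem' := fun {a b} ha hb => ⟨by rw [map_mul, ha.1, hb.1, mul_one], by
        rw [hD, ha.1, one_smul]; exact add_mem ha.2 hb.2⟩
      inv_mem' := fun {a} ha => by
        have h1 : ρ a⁻¹ = 1 := by
          have := map_mul ρ a⁻¹ a
          rwa [inv_mul_cancel, map_one, ha.1, mul_one, eq_comm] at this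
        exact ⟨h1, by rw [hD.apply_inv, h1, one_smul]; exact neg_mem ha.2⟩ }
  have : N.Normal := ⟨fun a ha g => ⟨by
      rw [map_mul, map_mul, ha.1, mul_one, ← map_mul, mul_inv_cancel, map_one], by
      rw [hD.apply_conj g ha.1]; exact Submodule.smul_mem _ _ ha.2⟩⟩
  exact Subgroup.normalClosure_le_normal (N := N)
    (fun r hr => ⟨hρ r hr, Submodule.subset_span ⟨⟨r, hr⟩, rfl⟩⟩) hr

section Presentation

variable {B : Type u} [Group B] {X : Type u} {rels : Set (FreeGroup X)} {q : FreeGroup X →* B}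

/-- Where the hypothesis on `H_2` enters: if it is spanned by classes from a subgroup that dies in
`Γ`, then every rational relation between the augmented Fox derivatives of the relators lifts to
`ℚ[Γ]`. -/
lemma exists_lift_relation (hq : Function.Surjective q) (hker : q.ker = Subgroup.normalClosure rels)
    {Γ : Type u} [Group Γ] (π : B →* Γ) (M : Subgroup B) (hM : M ≤ π.ker)
    (hH2 : rationalSurfaceSpan M = ⊤) {D : FreeGroup X → X →₀ MonoidAlgebra ℚ Γ}
    (hD : IsCrossedHom ((of ℚ Γ).comp (π.comp q)) D)
    (hof : ∀ x, D (FreeGroup.of x) = Finsupp.single x 1) (c : rels →₀ ℚ)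
    (hc : Finsupp.linearCombination ℚ (fun j : rels => augVec X Γ (D j)) c = 0) :
    ∃ l : rels →₀ MonoidAlgebra ℚ Γ,
      Finsupp.linearCombination (MonoidAlgebra ℚ Γ) (fun j : rels => D j) l = 0 ∧
        augVec rels Γ l = c := by
  have hρ : ∀ u, q u ∈ M → ((of ℚ Γ).comp (π.comp q)) u = 1 := fun u hu => by
    have : π (q u) = 1 := hM hu
    simp [this, MonoidAlgebra.one_def]
  have hrels : ∀ r ∈ rels, ((of ℚ Γ).comp (π.comp q)) r = 1 := fun r hr => hρ r (by
    have : r ∈ q.ker := hker ▸ Subgroup.subset_normalClosure hr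
    rw [MonoidHom.mem_ker.mp this]; exact one_mem M)
  let d : (rels →₀ MonoidAlgebra ℚ Γ) →ₗ[MonoidAlgebra ℚ Γ] (X →₀ MonoidAlgebra ℚ Γ) :=
    Finsupp.linearCombination (MonoidAlgebra ℚ Γ) fun j : rels => D j
  have hdspan : ∀ r, q r = 1 → ∃ l, d l = D r := fun r hr => by
    have := (mem_span_of_mem_normalClosure hD rels hrels (hker ▸ (MonoidHom.mem_ker.mpr hr))).2
    rw [← Finsupp.range_linearCombination] at this
    exact this
  -- `L₀` consists of the rational relations that lift; the claim is that `c` vanishes modulo `L₀`.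
  let L₀ : Submodule ℚ (rels →₀ ℚ) := (LinearMap.ker (d.restrictScalars ℚ)).map (augVec rels Γ)
  obtain ⟨p, hp⟩ := exists_comp_eq_of_ker_le (d.restrictScalars ℚ)
    (L₀.mkQ.comp (augVec rels Γ)) fun l hl => by
      rw [LinearMap.mem_ker, LinearMap.comp_apply, Submodule.mkQ_apply,
        Submodule.Quotient.mk_eq_zero]
      exact Submodule.mem_map_of_mem hl
  obtain ⟨χ, hχ⟩ := exists_hom_extending q hq M hH2 (fun w => p (D w))
    (fun u v hu _ => by rw [hD, hρ u hu, one_smul, map_add])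
    (fun w r hr => by
      obtain ⟨l, hl⟩ := hdspan r hr
      have hr1 : ((of ℚ Γ).comp (π.comp q)) r = 1 := hρ r (hr ▸ one_mem M)
      rw [hD.apply_conj w hr1, ← hl, ← map_smul]
      refine (hp _).trans (Eq.trans ?_ (hp _).symm)
      simp [augVec_smul])
  obtain ⟨L, hL⟩ := exists_linear_of_hom hD hof χ
  have hLp : ∀ j : rels, L (augVec X Γ (D j)) = L₀.mkQ (Finsupp.single j 1) := by
    intro j
    have hj : q j = 1 := MonoidHom.mem_ker.mp (hker ▸ Subgroup.subset_normalClosure j.2)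
    rw [hL, hχ j hj, toAdd_ofAdd]
    have := hp (Finsupp.single j 1)
    simpa [d] using this
  have hcomp : L.comp (Finsupp.linearCombination ℚ (fun j : rels => augVec X Γ (D j))) =
      L₀.mkQ := by
    refine Finsupp.lhom_ext' fun j => LinearMap.ext_ring ?_
    simpa using hLp j
  have hcL : L₀.mkQ c = 0 := by rw [← hcomp, LinearMap.comp_apply, hc, map_zero]
  rw [Submodule.mkQ_apply, Submodule.Quotient.mk_eq_zero] at hcL
  obtain ⟨l, hl, rfl⟩ := hcL
  exact ⟨l, hl, rfl⟩

/-- Where the hypothesis on `H_1` enters: elements with independent rational classes have augmented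
Fox derivatives that are independent modulo those of the relators. -/
lemma eq_zero_of_rational_relation (hker : q.ker = Subgroup.normalClosure rels)
    {Γ : Type u} [Group Γ] (π : B →* Γ) {D : FreeGroup X → X →₀ MonoidAlgebra ℚ Γ}
    (hD : IsCrossedHom ((of ℚ Γ).comp (π.comp q)) D)
    (hof : ∀ x, D (FreeGroup.of x) = Finsupp.single x 1) {S : Type u} (b : S → FreeGroup X)
    (hS : LinearIndependent ℚ fun a => rationalClass B (q (b a))) (μ : S →₀ ℚ)
    (hμ : Finsupp.linearCombination ℚ (fun a => augVec X Γ (D (b a))) μ ∈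
      Submodule.span ℚ (Set.range fun j : rels => augVec X Γ (D j))) : μ = 0 := by
  obtain ⟨L, hL⟩ := exists_linear_of_hom hD hof ((rationalClassHom B).comp q)
  have hle : Submodule.span ℚ (Set.range fun j : rels => augVec X Γ (D j)) ≤ LinearMap.ker L := by
    rw [Submodule.span_le]
    rintro _ ⟨j, rfl⟩
    have hj : q j = 1 := MonoidHom.mem_ker.mp (hker ▸ Subgroup.subset_normalClosure j.2)
    simp [hL, hj]
  have h0 : L (Finsupp.linearCombination ℚ (fun a => augVec X Γ (D (b a))) μ) = 0 := hle hμ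
  refine linearIndependent_iff.mp hS μ ?_
  rw [← h0, Finsupp.apply_linearCombination]
  congr 2
  ext1 a
  exact (hL (b a)).symm

/-- The inductive step: if `φ x` is torsion in the abelianization of `ker π`, then the Fox derivatives
of `x` vanish over `ℚ[Γ]`, so `x` is trivial in the abelianization of `ker (π ∘ φ)`. -/
theorem mem_commutator_of_pow_mem_commutator (hq : Function.Surjective q)
    (hker : q.ker = Subgroup.normalClosure rels) (hfin : rels.Finite)
    {Γ : Type u} [Group Γ] (hΓ : IsTame Γ) (π : B →* Γ) (M : Subgroup B) (hM : M ≤ π.ker)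
    (hH2 : rationalSurfaceSpan M = ⊤) {S : Type u} (φ : FreeGroup S →* B)
    (hS : LinearIndependent ℚ fun a => rationalClass B (φ (FreeGroup.of a)))
    {x : FreeGroup S} (hx : φ x ∈ π.ker) {i : ℕ} (hi : 0 < i)
    (hxi : φ x ^ i ∈ ⁅π.ker, π.ker⁆) : x ∈ ⁅(π.comp φ).ker, (π.comp φ).ker⁆ := by
  have := hfin.fintype
  let ρ : FreeGroup X →* MonoidAlgebra ℚ Γ := (of ℚ Γ).comp (π.comp q)
  have hρ : ∀ u, q u ∈ π.ker → ρ u = 1 := fun u hu => by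
    have : π (q u) = 1 := hu
    simp [ρ, this, MonoidAlgebra.one_def]
  have hrels : ∀ r ∈ rels, ρ r = 1 := fun r hr => hρ r (by
    have : r ∈ q.ker := hker ▸ Subgroup.subset_normalClosure hr
    rw [MonoidHom.mem_ker.mp this]; exact one_mem _)
  obtain ⟨D, hD, hof⟩ := exists_isCrossedHom ρ fun x => Finsupp.single x (1 : MonoidAlgebra ℚ Γ)
  obtain ⟨b, hb⟩ : ∃ b : S → FreeGroup X, ∀ a, q (b a) = φ (FreeGroup.of a) :=
    ⟨fun a => Function.surjInv hq _, fun a => Function.surjInv_eq hq _⟩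
  let β : FreeGroup S →* FreeGroup X := FreeGroup.lift b
  have hβ : q.comp β = φ := by ext a; simp [β, hb]
  have hβ' : ∀ w, q (β w) = φ w := fun w => DFunLike.congr_fun hβ w
  obtain ⟨E, hE, hEof⟩ := exists_isCrossedHom ((of ℚ Γ).comp (π.comp φ))
    fun a : S => Finsupp.single a (1 : MonoidAlgebra ℚ Γ)
  let e : S → X →₀ MonoidAlgebra ℚ Γ := fun a => D (b a)
  -- the chain rule for Fox derivatives
  have hDE : ∀ w, D (β w) = Finsupp.linearCombination (MonoidAlgebra ℚ Γ) e (E w) := by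
    have h1 : IsCrossedHom ((of ℚ Γ).comp (π.comp φ)) fun w => D (β w) := fun u v => by
      simp only [map_mul, hD (β u) (β v)]
      simp [ρ, hβ']
    have h2 := hE.map ((of ℚ Γ).comp (π.comp φ))
      (Finsupp.linearCombination (MonoidAlgebra ℚ Γ) e).toAddMonoidHom fun u m => by simp
    refine h1.ext_freeGroup h2 fun a => ?_
    simp [β, hEof, e]
  -- some power of `β x` is a relator times an element killed by `D`
  have hpow : D (β x ^ i) ∈
      Submodule.span (MonoidAlgebra ℚ Γ) (Set.range fun j : rels => D j) := by
    let N := π.ker.comap q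
    have hmap : (⁅N, N⁆ : Subgroup (FreeGroup X)).map q = ⁅π.ker, π.ker⁆ := by
      rw [Subgroup.map_commutator, Subgroup.map_comap_eq_self_of_surjective hq]
    obtain ⟨c, hc, hcx⟩ := hmap.symm ▸ hxi
    have hr : c⁻¹ * β x ^ i ∈ q.ker := by
      rw [MonoidHom.mem_ker, map_mul, map_inv, hcx, map_pow, hβ', inv_mul_cancel]
    have h1 := hD c (c⁻¹ * β x ^ i)
    rw [mul_inv_cancel_left, hD.apply_eq_zero_of_mem_commutator (fun u hu => hρ u hu) hc,
      hρ c (Subgroup.commutator_le_left N N hc), one_smul, zero_add] at h1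
    rw [h1]
    exact (mem_span_of_mem_normalClosure hD rels hrels (hker ▸ hr)).2
  have hDx : D (β x) ∈ Submodule.span (MonoidAlgebra ℚ Γ) (Set.range fun j : rels => D j) := by
    rw [hD.apply_pow (hρ _ (by rwa [hβ']))] at hpow
    have h2 := Submodule.smul_of_tower_mem _ ((i : ℚ)⁻¹) hpow
    rwa [← Nat.cast_smul_eq_nsmul ℚ, smul_smul, inv_mul_cancel₀ (by positivity), one_smul] at h2
  rw [hDE] at hDx
  have hEx : E x = 0 :=
    eq_zero_of_mem_span_relations hΓ e (fun j : rels => D j)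
      (eq_zero_of_rational_relation hker π hD hof b (by simpa only [hb] using hS))
      (exists_lift_relation hq hker π M hM hH2 hD hof) (E x) hDx
  exact mem_commutator_of_fox (π.comp φ) hE hEof hx hEx

/-- That the rational derived series of `B` absorbs torsion makes the induction work: it keeps the
quotients `B ⧸ rationalDerivedSeries B k` tame. -/
theorem comap_rationalDerivedSeries_le (hq : Function.Surjective q)
    (hker : q.ker = Subgroup.normalClosure rels) (hfin : rels.Finite) {S : Type u}
    (φ : FreeGroup S →* B)
    (hS : LinearIndependent ℚ fun a => rationalClass B (φ (FreeGroup.of a))) (m : ℕ)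
    (hH2 : rationalSurfaceSpan (derivedSeries B m) = ⊤) (k : ℕ) (hk : k ≤ m + 1) :
    (rationalDerivedSeries B k).comap φ ≤ derivedSeries (FreeGroup S) k := by
  induction k with
  | zero => exact le_top
  | succ k ih =>
    have ih := ih (by omega)
    intro x hx
    obtain ⟨hxk, i, hi, hxi⟩ := mem_rationalDerivedSeries_succ.mp hx
    let π : B →* B ⧸ rationalDerivedSeries B k := QuotientGroup.mk' _
    have hπ : π.ker = rationalDerivedSeries B k := QuotientGroup.ker_mk' _
    have hM : derivedSeries B m ≤ π.ker := by
      rw [hπ]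
      exact (derivedSeries_antitone B (by omega)).trans (derivedSeries_le_rationalDerivedSeries k)
    have hK : (π.comp φ).ker ≤ derivedSeries (FreeGroup S) k := by
      rw [← MonoidHom.comap_ker, hπ]; exact ih
    exact Subgroup.commutator_mono hK hK (mem_commutator_of_pow_mem_commutator hq hker hfin
      (isTame_quotient_rationalDerivedSeries B k) π _ hM hH2 φ hS (by rwa [hπ]) hi (by rwa [hπ]))

end Presentation

/-- A homomorphism from a free group to `B` with rationally independent values on the generators
reflects the derived series up to the `n`-th term. -/
theorem mem_derivedSeries_of_map_mem {B : Type u} [Group B] (hB : FinitelyRelated B) {S : Type u}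
    (φ : FreeGroup S →* B)
    (hS : LinearIndependent ℚ fun a => rationalClass B (φ (FreeGroup.of a))) (n : ℕ) (hn : 1 ≤ n)
    (hH2 : rationalSurfaceSpan (derivedSeries B (n - 1)) = ⊤) {x : FreeGroup S}
    (hx : φ x ∈ derivedSeries B n) : x ∈ derivedSeries (FreeGroup S) n := by
  obtain ⟨X, rels, hfin, ⟨e⟩⟩ := hB
  let q : FreeGroup X →* B := e.symm.toMonoidHom.comp (PresentedGroup.mk rels)
  have hq : Function.Surjective q := e.symm.surjective.comp (PresentedGroup.mk_surjective rels)
  have hker : q.ker = Subgroup.normalClosure rels := by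
    ext w
    simp [q, MonoidHom.mem_ker, PresentedGroup.mk_eq_one_iff]
  exact comap_rationalDerivedSeries_le hq hker hfin φ hS (n - 1) hH2 n (by omega)
    (derivedSeries_le_rationalDerivedSeries n hx)

/-! ### Free solvable groups are not nilpotent -/

lemma not_isNilpotent_perm_fin_three : ¬ Group.IsNilpotent (Equiv.Perm (Fin 3)) := by
  rintro ⟨n, hn⟩
  have hc : ∀ x : Equiv.Perm (Fin 3), (∀ y, x * y * x⁻¹ * y⁻¹ = 1) → x = 1 := by decide
  have h : ∀ n, Subgroup.upperCentralSeries (Equiv.Perm (Fin 3)) n = ⊥ := by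
    intro n
    induction n with
    | zero => rfl
    | succ n ih =>
      refine (Subgroup.eq_bot_iff_forall _).mpr fun x hx => hc x fun y => ?_
      have := Subgroup.mem_upperCentralSeries_succ_iff.mp hx y
      rwa [ih, Subgroup.mem_bot] at this
  rw [h n] at hn
  exact bot_ne_top hn

lemma derivedSeries_perm_fin_three {n : ℕ} (hn : 2 ≤ n) :
    derivedSeries (Equiv.Perm (Fin 3)) n = ⊥ := by
  refine le_bot_iff.mp ((derivedSeries_antitone _ hn).trans ?_)
  have h1 : derivedSeries (Equiv.Perm (Fin 3)) 1 ≤ alternatingGroup (Fin 3) := by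
    rw [derivedSeries_one]
    exact Abelianization.commutator_subset_ker _
  refine (Subgroup.commutator_mono h1 h1).trans (Subgroup.commutator_le.mpr ?_)
  have : ∀ x y : Equiv.Perm (Fin 3), x.sign = 1 → y.sign = 1 →
      x * y * x⁻¹ * y⁻¹ = 1 := by decide
  exact fun x hx y hy => this x y hx hy

/-- The free solvable group of rank and derived length at least two maps onto the symmetric group
`S₃`. -/
lemma not_isNilpotent_derivedQuotient_freeGroup {S : Type u} [Nontrivial S] {n : ℕ} (hn : 2 ≤ n) :
    ¬ Group.IsNilpotent (derivedQuotient (FreeGroup S) n) := by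
  classical
  intro h
  obtain ⟨a, b, hab⟩ := exists_pair_ne S
  let s : Equiv.Perm (Fin 3) := Equiv.swap 0 1
  let t : Equiv.Perm (Fin 3) := Equiv.swap 1 2
  let g : FreeGroup S →* Equiv.Perm (Fin 3) :=
    FreeGroup.lift fun x => if x = a then s else if x = b then t else 1
  have ha : g (FreeGroup.of a) = s := by simp [g]
  have hb : g (FreeGroup.of b) = t := by simp [g, hab.symm]
  have hg : Function.Surjective g := by
    have hst : ∀ x : Equiv.Perm (Fin 3), x = 1 ∨ x = Equiv.swap 0 1 ∨ x = Equiv.swap 1 2 ∨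
        x = Equiv.swap 0 1 * Equiv.swap 1 2 ∨ x = Equiv.swap 1 2 * Equiv.swap 0 1 ∨
        x = Equiv.swap 0 1 * Equiv.swap 1 2 * Equiv.swap 0 1 := by decide
    intro x
    rcases hst x with rfl | rfl | rfl | rfl | rfl | rfl
    · exact ⟨1, map_one g⟩
    · exact ⟨_, ha⟩
    · exact ⟨_, hb⟩
    · exact ⟨FreeGroup.of a * FreeGroup.of b, by rw [map_mul, ha, hb]⟩
    · exact ⟨FreeGroup.of b * FreeGroup.of a, by rw [map_mul, ha, hb]⟩
    · exact ⟨FreeGroup.of a * FreeGroup.of b * FreeGroup.of a, by rw [map_mul, map_mul, ha, hb]⟩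
  have hle : derivedSeries (FreeGroup S) n ≤ g.ker := fun x hx => by
    have := map_derivedSeries_le_derivedSeries g n (Subgroup.mem_map_of_mem g hx)
    rwa [derivedSeries_perm_fin_three hn, Subgroup.mem_bot] at this
  exact not_isNilpotent_perm_fin_three (Group.nilpotent_of_surjective
    (QuotientGroup.lift _ g hle) (QuotientGroup.lift_surjective_of_surjective _ _ hg hle))

end GroupRings

lemma freeToClosure_surjective {B : Type u} [Group B] (S : Set B) :
    Function.Surjective (freeToClosure S) := by
  rw [← MonoidHom.range_eq_top]
  apply Subgroup.map_injective (Subgroup.closure S).subtype_injective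
  rw [← MonoidHom.range_comp, ← MonoidHom.range_eq_map, Subgroup.range_subtype]
  refine le_antisymm ?_ (Subgroup.closure_le _ |>.mpr fun a ha => ⟨FreeGroup.of ⟨a, ha⟩, ?_⟩)
  · rintro _ ⟨x, rfl⟩
    exact (freeToClosure S x).2
  · simp [freeToClosure]

theorem proposition4p1 {B : Type u} [Group B] (hB : FinitelyRelated B) (S : Set B) (n : ℕ)
    (hn : 1 ≤ n)
    (hS : LinearIndependent ℚ fun a : S => rationalClass B (a : B))
    (hH2 : rationalSurfaceSpan (derivedSeries B (n - 1)) = ⊤) :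
    Function.Bijective (derivedQuotientMap (freeToClosure S) n) ∧
    (∃ f : Subgroup.closure S →* derivedQuotient (FreeGroup S) n, Function.Surjective f ∧
      ∀ a : S, f ⟨a, Subgroup.subset_closure a.2⟩ = QuotientGroup.mk (FreeGroup.of a)) ∧
    (2 ≤ n → S.Nontrivial → ¬ Group.IsNilpotent (Subgroup.closure S)) ∧
    Function.Injective (derivedQuotientMap (Subgroup.closure S).subtype n) := by
  let φ : FreeGroup S →* B := (Subgroup.closure S).subtype.comp (freeToClosure S)
  have hφ : ∀ a : S, φ (FreeGroup.of a) = a := fun a => by simp [φ, freeToClosure]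
  have hsurj := freeToClosure_surjective S
  have key : ∀ x : FreeGroup S, φ x ∈ derivedSeries B n → x ∈ derivedSeries (FreeGroup S) n :=
    fun x hx => mem_derivedSeries_of_map_mem hB φ (by simpa only [hφ] using hS) n hn hH2 hx
  have hinj : Function.Injective (derivedQuotientMap (freeToClosure S) n) := by
    refine (injective_iff_map_eq_one _).mpr fun x hx => ?_
    obtain ⟨x, rfl⟩ := QuotientGroup.mk_surjective x
    refine (QuotientGroup.eq_one_iff _).mpr (key x ?_)
    exact map_derivedSeries_le_derivedSeries (Subgroup.closure S).subtype n
      (Subgroup.mem_map_of_mem _ ((QuotientGroup.eq_one_iff _).mp hx))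
  have hbij : Function.Bijective (derivedQuotientMap (freeToClosure S) n) := by
    refine ⟨hinj, fun y => ?_⟩
    obtain ⟨y, rfl⟩ := QuotientGroup.mk_surjective y
    obtain ⟨x, rfl⟩ := hsurj y
    exact ⟨QuotientGroup.mk x, rfl⟩
  let e := MulEquiv.ofBijective _ hbij
  let f : Subgroup.closure S →* derivedQuotient (FreeGroup S) n :=
    e.symm.toMonoidHom.comp (QuotientGroup.mk' _)
  have hf : Function.Surjective f := e.symm.surjective.comp (QuotientGroup.mk'_surjective _)
  refine ⟨hbij, ⟨f, hf, fun a => ?_⟩, fun h2 hS2 hnil => ?_, ?_⟩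
  · refine e.symm_apply_eq.mpr ?_
    change _ = ((freeToClosure S (FreeGroup.of a) : Subgroup.closure S) :
      derivedQuotient (Subgroup.closure S) n)
    simp [freeToClosure]
  · have : Nontrivial S := hS2.coe_sort
    exact not_isNilpotent_derivedQuotient_freeGroup h2 (Group.nilpotent_of_surjective f hf)
  · refine (injective_iff_map_eq_one _).mpr fun y hy => ?_
    obtain ⟨y, rfl⟩ := QuotientGroup.mk_surjective y
    obtain ⟨x, rfl⟩ := hsurj y
    have hx : x ∈ derivedSeries (FreeGroup S) n := key x ((QuotientGroup.eq_one_iff _).mp hy)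
    exact (QuotientGroup.eq_one_iff _).mpr (map_derivedSeries_le_derivedSeries (freeToClosure S) n
      (Subgroup.mem_map_of_mem _ hx))
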